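/- **Setting.** Let $\chi$ be a real primitive Dirichlet character of modulus $D$, where $D$ exceeds a sufficiently large absolute constant. Put $$\mathcal L=\log D,\qquad Q=\exp(\mathcal L^2),\qquad \alpha=(\log Q)^{-1}=\mathcal L^{-2},\qquad s_0=\tfrac12+iD .$$ Define $$\Omega=\{s:\ |\Re(s-s_0)|<\tfrac12,\ |\Im(s-s_0)|<10\mathcal L\},$$ $$\Omega_1=\{s:\ -2\alpha^{1/2}<\Re(s-s_0)<1,\ |\Im(s-s_0)|<1+20\mathcal L\},$$ $$\Omega_2=\{s:\ -\tfrac1{10}\alpha\log\mathcal L<\Re(s-s_0)<\tfrac12,\ |\Im(s-s_0)|<1+10\mathcal L\}.$$ Let $\Psi$ be the set of all primitive characters $\psi$ modulo $q$, where $q$ runs over the squarefree integers with $Q<q<2Q$ and $(6,q)=1$, such that $\psi\chi$ is a primitive character modulo $[q,D]$. Define $\nu$ and $\upsilon$ by $\sum_n\nu(n)n^{-s}=\zeta(s)L(s,\chi)$ and $\sum_n\upsilon(n)n^{-s}=\zeta(s)^{-1}L(s,\chi)^{-1}$, and put $$F(s,\psi)=\sum_{n\le D^5}\frac{\nu(n)\psi(n)}{n^s},\qquad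 G(s,\psi)=\sum_{n\le D^5}\frac{\upsilon(n)\psi(n)}{n^s}.$$ For a primitive character $\psi$ let $\Delta(s,\psi)$ be the meromorphic function $L(s,\psi)/L(1-s,\bar\psi)$. For $\psi\in\Psi$ put $$\Delta_1(s,\psi)=\Delta(s,\psi)\,\Delta(s,\psi\chi),\qquad \mathcal F(s,\psi)=F(s,\psi)+\Delta_1(s,\psi)F(1-s,\bar\psi).$$ Let $\Psi^*$ be the set of all $\psi\in\Psi$ that satisfy the three inequalities $$\sup_{s\in\Omega_1}\big\{|F(s,\psi)|+|G(s,\psi)|\big\}<\mathcal L^3\log\mathcal L,\tag{I1}$$ $$\sup_{s\in\Omega_1}|F(s,\psi)G(s,\psi)-1|<\tfrac12,\tag{I2}$$ $$\sup_{s\in\Omega_2}|L(s,\psi)L(s,\psi\chi)-\mathcal F(s,\psi)|<\mathcal L^{-24/5}.\tag{I3}$$ **Proposition 3.1.** Suppose $\psi\in\Psi^*$. Then the following hold. (i) All the zeros of $L(s,\psi)L(s,\psi\chi)$ in $\Omega$ lie on the critical line $\Re s=\frac12$. (ii) All the zeros of $L(s,\psi)L(s,\psi\chi)$ in $\Omega$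 are simple. (iii) If $\rho_1,\rho_2$ is a pair of consecutive zeros of $L(s,\psi)L(s,\psi\chi)$ in $\Omega$ (ordered by imaginary part), then $$|\rho_1-\rho_2|=\pi\alpha+O\big(\mathcal L^{-3}(\log\mathcal L)^2\big),$$ where the implied constant is absolute. -/

import Mathlib

namespace DirichletZeros

open Complex

noncomputable section

/-- The least common multiple of two positive moduli is positive. -/
instance neZeroLcm (m n : ℕ) [NeZero m] [NeZero n] : NeZero (Nat.lcm m n) :=
  ⟨Nat.lcm_ne_zero (NeZero.ne m) (NeZero.ne n)⟩

/-! ### Parameters attached to the modulus `D` -/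

/-- `ℒ = log D`. -/
def logD (D : ℕ) : ℝ := Real.log D

/-- `Q = exp (ℒ ^ 2)`. -/
def bigQ (D : ℕ) : ℝ := Real.exp (logD D ^ 2)

/-- `α = 1 / log Q`, that is `ℒ ^ (-2)`. -/
def alpha (D : ℕ) : ℝ := (Real.log (bigQ D))⁻¹

/-- `s₀ = 1 / 2 + i D`. -/
def s₀ (D : ℕ) : ℂ := 1 / 2 + I * D

/-- The box `Ω`. -/
def Omega (D : ℕ) : Set ℂ :=
  {s | |(s - s₀ D).re| < 1 / 2 ∧ |(s - s₀ D).im| < 10 * logD D}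

/-- The domain `Ω₁`. -/
def Omega₁ (D : ℕ) : Set ℂ :=
  {s | -2 * √(alpha D) < (s - s₀ D).re ∧ (s - s₀ D).re < 1 ∧
    |(s - s₀ D).im| < 1 + 20 * logD D}

/-- The domain `Ω₂`. -/
def Omega₂ (D : ℕ) : Set ℂ :=
  {s | -(1 / 10) * alpha D * Real.log (logD D) < (s - s₀ D).re ∧ (s - s₀ D).re < 1 / 2 ∧
    |(s - s₀ D).im| < 1 + 10 * logD D}

/-! ### The coefficients `ν` and `υ` -/

/-- The coefficients of the Dirichlet series of `ζ(s) L(s, χ)`. -/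
def nu {D : ℕ} (χ : DirichletCharacter ℂ D) (n : ℕ) : ℂ :=
  ∑ p ∈ n.divisorsAntidiagonal, χ p.2

/-- The coefficients of the Dirichlet series of `ζ(s)⁻¹ L(s, χ)⁻¹`. -/
def upsilon {D : ℕ} (χ : DirichletCharacter ℂ D) (n : ℕ) : ℂ :=
  ∑ p ∈ n.divisorsAntidiagonal,
    (ArithmeticFunction.moebius p.1 : ℂ) * (χ p.2 * (ArithmeticFunction.moebius p.2 : ℂ))

theorem LSeries_nu {D : ℕ} [NeZero D] (χ : DirichletCharacter ℂ D) {s : ℂ} (hs : 1 < s.re) :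
    LSeries (nu χ) s = riemannZeta s * χ.LFunction s := by
  have h : nu χ = LSeries.convolution 1 (fun n => χ n) := by
    rw [LSeries.convolution_def]
    funext n
    simp [nu]
  rw [h, LSeries_convolution' (LSeriesSummable_one_iff.mpr hs) (χ.LSeriesSummable_of_one_lt_re hs),
    LSeries_one_eq_riemannZeta hs, χ.LFunction_eq_LSeries hs]

theorem LSeries_upsilon {D : ℕ} [NeZero D] (χ : DirichletCharacter ℂ D) {s : ℂ}
    (hs : 1 < s.re) :
    LSeries (upsilon χ) s = (riemannZeta s)⁻¹ * (χ.LFunction s)⁻¹ := by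
  have h : upsilon χ = LSeries.convolution (fun n => (ArithmeticFunction.moebius n : ℂ))
      ((fun n : ℕ => χ n) * fun n : ℕ => (ArithmeticFunction.moebius n : ℂ)) := by
    rw [LSeries.convolution_def]
    funext n
    simp [upsilon]
  have hμ := ArithmeticFunction.LSeriesSummable_moebius_iff.mpr hs
  rw [h, LSeries_convolution' hμ (χ.LSeriesSummable_mul hμ), χ.LFunction_eq_LSeries hs]
  congr 1
  · apply eq_inv_of_mul_eq_one_right
    rw [← LSeries_one_eq_riemannZeta hs]
    exact LSeries_one_mul_Lseries_moebius hs
  · exact eq_inv_of_mul_eq_one_right (DirichletCharacter.LSeries.mul_mu_eq_one χ hs)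

/-! ### The Dirichlet polynomials `F`, `G` and the function `𝓕` -/

/-- `F(s, ψ) = ∑_{n ≤ D ^ 5} ν(n) ψ(n) n ^ (-s)`. -/
def F {D q : ℕ} (χ : DirichletCharacter ℂ D) (ψ : DirichletCharacter ℂ q) (s : ℂ) : ℂ :=
  ∑ n ∈ Finset.Icc 1 (D ^ 5), nu χ n * ψ n / (n : ℂ) ^ s

/-- `G(s, ψ) = ∑_{n ≤ D ^ 5} υ(n) ψ(n) n ^ (-s)`. -/
def G {D q : ℕ} (χ : DirichletCharacter ℂ D) (ψ : DirichletCharacter ℂ q) (s : ℂ) : ℂ :=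
  ∑ n ∈ Finset.Icc 1 (D ^ 5), upsilon χ n * ψ n / (n : ℂ) ^ s

/-- The factor `Δ(s, ψ)` of the functional equation `L(s, ψ) = Δ(s, ψ) L(1 - s, ψ̄)` of a primitive
character `ψ` modulo `k`. As a meromorphic function it is the quotient `L(s, ψ) / L(1 - s, ψ̄)`;
it is written here through gamma factors, so that it has the right value also where
`L(1 - s, ψ̄)` vanishes. With `a = 0` for `ψ` even and `a = 1` for `ψ` odd it is
`C(ψ) (k / π) ^ (1 / 2 - s) Γ((1 - s + a) / 2) / Γ((s + a) / 2)`, where `|C(ψ)| = 1`. -/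
def Delta {k : ℕ} [NeZero k] (ψ : DirichletCharacter ℂ k) (s : ℂ) : ℂ :=
  ψ.rootNumber * (k : ℂ) ^ (1 / 2 - s) * (ψ.gammaFactor (1 - s) / ψ.gammaFactor s)

/-- Off the real axis (hence on all the domains above, once `D` is large) `Delta` is the factor of
the functional equation. Here `ψ⁻¹` is the complex conjugate of `ψ`. -/
theorem LFunction_eq_Delta_mul {k : ℕ} [NeZero k] {ψ : DirichletCharacter ℂ k}
    (hψ : ψ.IsPrimitive) {s : ℂ} (hs : s.im ≠ 0) :
    ψ.LFunction s = Delta ψ s * ψ⁻¹.LFunction (1 - s) := by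
  have hg : ∀ w : ℂ, w.im ≠ 0 → ψ.gammaFactor w ≠ 0 := by
    intro w hw h
    rcases ψ.even_or_odd with he | ho
    · rw [he.gammaFactor_def, Complex.Gammaℝ_eq_zero_iff] at h
      obtain ⟨n, hn⟩ := h
      exact hw (by rw [hn]; simp)
    · rw [ho.gammaFactor_def, Complex.Gammaℝ_eq_zero_iff] at h
      obtain ⟨n, hn⟩ := h
      apply hw
      have : w = -(2 * n) - 1 := by rw [← hn]; ring
      rw [this]; simp
  have hinv : ψ⁻¹.gammaFactor (1 - s) = ψ.gammaFactor (1 - s) := by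
    rcases ψ.even_or_odd with he | ho
    · have he' : ψ⁻¹.Even := by
        unfold DirichletCharacter.Even at *
        rw [MulChar.inv_apply_eq_inv', he]; simp
      rw [he.gammaFactor_def, he'.gammaFactor_def]
    · have ho' : ψ⁻¹.Odd := by
        unfold DirichletCharacter.Odd at *
        rw [MulChar.inv_apply_eq_inv', ho]; norm_num
      rw [ho.gammaFactor_def, ho'.gammaFactor_def]
  have h0 : s ≠ 0 := fun h => hs (by simp [h])
  have him : (1 - s).im ≠ 0 := by simpa using hs
  have h1 : (1 - s) ≠ 0 := fun h => him (by simp [h])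
  have hfe := hψ.completedLFunction_one_sub (1 - s)
  rw [show 1 - (1 - s) = s by ring, show 1 - s - 1 / 2 = 1 / 2 - s by ring] at hfe
  rw [ψ.LFunction_eq_completed_div_gammaFactor s (Or.inl h0),
    ψ⁻¹.LFunction_eq_completed_div_gammaFactor (1 - s) (Or.inl h1), hinv, hfe, Delta]
  have := hg s hs
  have := hg _ him
  field_simp

/-- `Δ₁(s, ψ) = Δ(s, ψ) Δ(s, ψχ)`; here `ψ.mul χ` is the character `ψχ` modulo `[q, D]`. -/
def Delta₁ {D q : ℕ} [NeZero D] [NeZero q] (χ : DirichletCharacter ℂ D)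
    (ψ : DirichletCharacter ℂ q) (s : ℂ) : ℂ :=
  Delta ψ s * Delta (ψ.mul χ) s

/-- `𝓕(s, ψ) = F(s, ψ) + Δ₁(s, ψ) F(1 - s, ψ̄)`. -/
def calF {D q : ℕ} [NeZero D] [NeZero q] (χ : DirichletCharacter ℂ D)
    (ψ : DirichletCharacter ℂ q) (s : ℂ) : ℂ :=
  F χ ψ s + Delta₁ χ ψ s * F χ ψ⁻¹ (1 - s)

/-- `L(s, ψ) L(s, ψχ)`. -/
def LL {D q : ℕ} [NeZero D] [NeZero q] (χ : DirichletCharacter ℂ D)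
    (ψ : DirichletCharacter ℂ q) (s : ℂ) : ℂ :=
  ψ.LFunction s * (ψ.mul χ).LFunction s

/-! ### The sets of characters `Ψ` and `Ψ*` -/

/-- The characters modulo `q` that belong to `Ψ`: there are none unless `Q < q < 2 Q`,
`(6, q) = 1` and `q` is squarefree, and then they are the primitive `ψ` modulo `q` for which
`ψχ` is primitive modulo `[q, D]`. -/
def Psi {D : ℕ} (χ : DirichletCharacter ℂ D) (q : ℕ) : Set (DirichletCharacter ℂ q) :=
  {ψ | bigQ D < q ∧ q < 2 * bigQ D ∧ Nat.Coprime 6 q ∧ Squarefree q ∧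
    ψ.IsPrimitive ∧ (ψ.mul χ).IsPrimitive}

/-- `sup_{s ∈ S} f(s) < b`. -/
def SupLT (S : Set ℂ) (f : ℂ → ℝ) (b : ℝ) : Prop :=
  ∃ B < b, ∀ s ∈ S, f s ≤ B

/-- The characters modulo `q` that belong to `Ψ*`. -/
def PsiStar {D : ℕ} [NeZero D] (χ : DirichletCharacter ℂ D) (q : ℕ) [NeZero q] :
    Set (DirichletCharacter ℂ q) :=
  {ψ | ψ ∈ Psi χ q ∧
    SupLT (Omega₁ D) (fun s => ‖F χ ψ s‖ + ‖G χ ψ s‖) (logD D ^ 3 * Real.log (logD D)) ∧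
    SupLT (Omega₁ D) (fun s => ‖F χ ψ s * G χ ψ s - 1‖) (1 / 2) ∧
    SupLT (Omega₂ D) (fun s => ‖LL χ ψ s - calF χ ψ s‖) (logD D ^ (-(24 / 5) : ℝ))}

/-- The zeros of `f` in `S`. -/
def zerosIn (f : ℂ → ℂ) (S : Set ℂ) : Set ℂ := {ρ | ρ ∈ S ∧ f ρ = 0}

/-- `ρ₁` and `ρ₂` are consecutive elements of `Z`, ordered by their imaginary parts. -/
def Consecutive (Z : Set ℂ) (ρ₁ ρ₂ : ℂ) : Prop :=
  ρ₁ ∈ Z ∧ ρ₂ ∈ Z ∧ ρ₁.im < ρ₂.im ∧ ∀ ρ ∈ Z, ¬ (ρ₁.im < ρ.im ∧ ρ.im < ρ₂.im)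

end

end DirichletZeros

/-!
On `Ω₁` the bounds for `F` and `G` and the closeness of `F G` to `1` make `F` zero-free, with
`log |F| = O(log ℒ)`. Hence one may write `L(s, ψ) L(s, ψχ) = F (1 + B + e)`, where
`B = Δ₁(s) F(1 - s, ψ̄) / F(s, ψ)` is `reflectedRatio` and `e`, which is `relError`, is
`O(log ℒ / ℒ)` on `Ω₂` because `𝓕` approximates `L(s, ψ) L(s, ψχ)` there.

Two facts about `B` drive everything. On the critical line `|B| = 1`, because `|Δ₁| = 1` there
and, `χ` being real, `F(1 - s, ψ̄)` is the conjugate of `F(1 - s̄, ψ)`. Near the line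
`B'/B = -2 ℒ² + O(ℒ log ℒ)` (`norm_logDeriv_reflectedRatio_add_le`): the main term is
`-log q - log [q, D]` from `Δ₁`; the gamma factors contribute `O(ℒ)` and the two factors `F`
contribute `O(ℒ log ℒ)`. Both bounds come from one principle, `norm_logDeriv_le_of_log_norm_mem`:
by Borel–Carathéodory, bounds for `log |f|` on a disc control `f'/f` at its centre. So only the
size of the gamma factors has to be known, and the beta integral gives it up to powers of the
height.

To the right of the line `|B|` decays, and at distance `9 / (5 ℒ)` the trivial bound for `F` takes
over, so a zero in `Ω` has `B ≈ -1` and lies within `O(ℒ⁻³ log ℒ)` of the line; zeros to the left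
are reflected by the functional equation (`abs_re_sub_half_le_of_zero`). Where `B ≈ -1`, the
derivative of `1 + B + e` has real part of order `ℒ²` (`NearCritical.re_deriv_pos`), since
Cauchy's estimate bounds `e'`. Thus zeros are simple; and a zero off the line together with its
mirror image would contradict Rolle's theorem on the chord between them.

On the line write `B = exp (2 i θ)` with `θ' = -ℒ² + O(ℒ log ℒ)`. The functional equation makes
`exp (-i θ) (1 + B + e)` real, equal to `2 cos θ` plus a small function with small derivative. By
the intermediate value theorem and Rolle's theorem `θ` drops by `π + O(log ℒ / ℒ)` between
consecutive zeros (`abs_zero_gap_sub_le_of_cos`), which gives the spacing `π / ℒ² + O(ℒ⁻³ log ℒ)`.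
-/

namespace DirichletZeros

open Complex

/-! ### Logarithmic derivatives and the spacing of real zeros -/

/-- If `log |f|` stays between `a` and `b` on a disc of radius `R`, then `f' / f` is
`O((b - a) / R)` at its centre: the Borel–Carathéodory theorem for a logarithm of `f`. -/
theorem norm_logDeriv_le_of_log_norm_mem {f : ℂ → ℂ} {c : ℂ} {R a b : ℝ} (hR : 0 < R)
    (hab : a < b)
    (hf : DifferentiableOn ℂ f (Metric.ball c R)) (h0 : ∀ z ∈ Metric.ball c R, f z ≠ 0)
    (ha : ∀ z ∈ Metric.ball c R, a ≤ Real.log ‖f z‖)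
    (hb : ∀ z ∈ Metric.ball c R, Real.log ‖f z‖ ≤ b) :
    ‖logDeriv f c‖ ≤ 8 * (b - a) / R := by
  have hc : c ∈ Metric.ball c R := Metric.mem_ball_self hR
  have hfd : DifferentiableOn ℂ (logDeriv f) (Metric.ball c R) := by
    have := (hf.deriv Metric.isOpen_ball).div hf h0
    exact this
  obtain ⟨g, hg⟩ := (hfd.isExactOn_ball).with_val_at c 0
  obtain ⟨hgc, hg⟩ := hg
  -- `g` is a logarithm of `f / f c`
  have hexp : ∀ z ∈ Metric.ball c R, f z = f c * exp (g z) := by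
    have hd : ∀ z ∈ Metric.ball c R, HasDerivAt (fun w => f w * exp (-g w)) 0 z := by
      intro z hz
      have h1 : HasDerivAt f (deriv f z) z :=
        (hf.differentiableAt (Metric.isOpen_ball.mem_nhds hz)).hasDerivAt
      have h2 := (hg z hz).neg.cexp
      have h3 := h1.mul h2
      convert! h3 using 1
      rw [logDeriv_apply]
      have := h0 z hz
      simp only [Pi.neg_apply]
      field_simp
      ring
    intro z hz
    have h4 := (convex_ball c R).is_const_of_fderivWithin_eq_zero (𝕜 := ℂ)
      (f := fun w => f w * exp (-g w))
      (fun w hw => (hd w hw).differentiableAt.differentiableWithinAt)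
      (fun w hw => by
        rw [fderivWithin_of_isOpen Metric.isOpen_ball hw]
        ext
        simp [(hd w hw).deriv]) hz hc
    simp only [hgc, neg_zero, exp_zero, mul_one] at h4
    rw [← h4, mul_assoc, ← exp_add]; simp
  have hre : ∀ z ∈ Metric.ball c R, (g z).re ≤ b - a := by
    intro z hz
    have h5 : Real.log ‖f z‖ = Real.log ‖f c‖ + (g z).re := by
      rw [hexp z hz, norm_mul, norm_exp, Real.log_mul (norm_ne_zero_iff.2 (h0 c hc))
        (Real.exp_ne_zero _), Real.log_exp]
    linarith [ha c hc, hb z hz]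
  -- Borel–Carathéodory on the disc of radius `R`, then Cauchy's estimate on the half as large one
  have hBC : ∀ z ∈ Metric.sphere c (R / 2), ‖g z‖ ≤ 4 * (b - a) := by
    intro z hz
    have hz' : ‖z - c‖ = R / 2 := by simpa [dist_eq_norm] using hz
    have key := borelCaratheodory_zero (f := fun w => g (w + c)) (M := b - a) (R := R)
      (z := z - c) (by linarith) ?_ ?_ hR ?_ (by simpa using hgc)
    · simp only [sub_add_cancel, hz'] at key
      refine key.trans ?_
      have hba : 0 ≤ b - a := by linarith
      rw [div_le_iff₀ (by linarith)]
      nlinarith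
    · intro w hw
      have hw' : w + c ∈ Metric.ball c R := by simpa [dist_eq_norm] using hw
      exact ((hg _ hw').comp_add_const w c).differentiableAt.differentiableWithinAt
    · intro w hw
      have hw' : w + c ∈ Metric.ball c R := by simpa [dist_eq_norm] using hw
      exact hre _ hw'
    · rw [mem_ball_zero_iff, hz']; linarith
  have hdc : DiffContOnCl ℂ g (Metric.ball c (R / 2)) := by
    apply DifferentiableOn.diffContOnCl
    rw [closure_ball c (by positivity)]
    intro w hw
    have hw' := Metric.closedBall_subset_ball (half_lt_self hR) hw
    exact (hg w hw').differentiableAt.differentiableWithinAt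
  have hfin := norm_deriv_le_of_forall_mem_sphere_norm_le (by positivity) hdc hBC
  rw [(hg c hc).deriv] at hfin
  refine hfin.trans (le_of_eq ?_)
  field_simp; ring

/-- The real part of `f' / f` is the derivative of `log |f|` along horizontal lines. -/
theorem norm_le_exp_mul_of_re_logDeriv_le {f : ℂ → ℂ} {a b t M : ℝ} (hab : a ≤ b)
    (hf : ∀ x ∈ Set.Icc a b, DifferentiableAt ℂ f (x + t * I))
    (h0 : ∀ x ∈ Set.Icc a b, f (x + t * I) ≠ 0)
    (hM : ∀ x ∈ Set.Icc a b, (logDeriv f (x + t * I)).re ≤ -M) :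
    ‖f (b + t * I)‖ ≤ Real.exp (-M * (b - a)) * ‖f (a + t * I)‖ := by
  set h : ℝ → ℝ := fun x => Real.log ‖f (x + t * I)‖ + M * x with hh
  have hd : ∀ x ∈ Set.Icc a b, HasDerivAt h ((logDeriv f (x + t * I)).re + M) x := by
    intro x hx
    have h1 : HasDerivAt (fun y : ℝ => f (y + t * I)) (deriv f (x + t * I)) x := by
      have h2 : HasDerivAt (fun y : ℂ => f (y + t * I)) (deriv f (x + t * I)) (x : ℂ) :=
        (hf x hx).hasDerivAt.comp_add_const _ _
      exact h2.comp_ofReal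
    have h3 := h1.norm_sq
    have h4 := (h3.log (by simpa using h0 x hx)).div_const 2
    have h5 := h4.add ((hasDerivAt_id x).const_mul M)
    convert! h5 using 1
    · funext y
      simp [hh, Real.log_pow]
    · rw [logDeriv_apply, div_eq_mul_inv, inv_def, Complex.inner]
      have : ‖f (x + t * I)‖ ≠ 0 := norm_ne_zero_iff.2 (h0 x hx)
      rw [← mul_assoc, re_mul_ofReal, Complex.normSq_eq_norm_sq]
      simp only [mul_one]
      field_simp
  have hanti : AntitoneOn h (Set.Icc a b) := by
    apply antitoneOn_of_deriv_nonpos (convex_Icc a b)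
    · exact fun x hx => (hd x hx).continuousAt.continuousWithinAt
    · exact fun x hx => (hd x (interior_subset hx)).differentiableAt.differentiableWithinAt
    · intro x hx
      rw [(hd x (interior_subset hx)).deriv]
      linarith [hM x (interior_subset hx)]
  have := hanti (Set.left_mem_Icc.2 hab) (Set.right_mem_Icc.2 hab) hab
  simp only [hh] at this
  have hpa : 0 < ‖f (a + t * I)‖ := norm_pos_iff.2 (h0 a (Set.left_mem_Icc.2 hab))
  have hpb : 0 < ‖f (b + t * I)‖ := norm_pos_iff.2 (h0 b (Set.right_mem_Icc.2 hab))
  rw [← Real.log_le_log_iff hpb (by positivity), Real.log_mul (Real.exp_ne_zero _) hpa.ne',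
    Real.log_exp]
  linarith

theorem norm_le_exp_mul_of_le_re_logDeriv {f : ℂ → ℂ} {a b t M : ℝ} (hab : a ≤ b)
    (hf : ∀ x ∈ Set.Icc a b, DifferentiableAt ℂ f (x + t * I))
    (h0 : ∀ x ∈ Set.Icc a b, f (x + t * I) ≠ 0)
    (hM : ∀ x ∈ Set.Icc a b, -M ≤ (logDeriv f (x + t * I)).re) :
    ‖f (a + t * I)‖ ≤ Real.exp (M * (b - a)) * ‖f (b + t * I)‖ := by
  have h := norm_le_exp_mul_of_re_logDeriv_le (f := f⁻¹) (t := t) (M := -M) hab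
    (fun x hx => (hf x hx).inv (h0 x hx)) (fun x hx => inv_ne_zero (h0 x hx))
    (fun x hx => by
      rw [logDeriv_apply, ((hf x hx).hasDerivAt.inv (h0 x hx)).deriv]
      have h1 := hM x hx
      rw [logDeriv_apply] at h1
      have : -deriv f (x + t * I) / f (x + t * I) ^ 2 / f⁻¹ (x + t * I) =
          -(deriv f (x + t * I) / f (x + t * I)) := by
        have := h0 x hx
        simp only [Pi.inv_apply]
        field_simp
      rw [this, neg_re]
      linarith)
  have ha : 0 < ‖f (a + t * I)‖ := norm_pos_iff.2 (h0 a (Set.left_mem_Icc.2 hab))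
  have hb : 0 < ‖f (b + t * I)‖ := norm_pos_iff.2 (h0 b (Set.right_mem_Icc.2 hab))
  simp only [Pi.inv_apply, norm_inv, neg_neg] at h
  rw [inv_le_iff_one_le_mul₀ hb] at h
  have h2 : 1 * ‖f (a + t * I)‖ ≤ Real.exp (M * (b - a)) * ‖f (a + t * I)‖⁻¹ *
      ‖f (b + t * I)‖ * ‖f (a + t * I)‖ := by gcongr
  calc _ = 1 * ‖f (a + t * I)‖ := (one_mul _).symm
    _ ≤ _ := h2
    _ = _ := by field_simp

/-- Where the sine is small, the argument is near a multiple of `π`. The constants are generous: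
`|sin x| ≥ (2 / π) |x|` gives `π ε / 4`. -/
theorem exists_abs_sub_int_mul_pi_le {y ε : ℝ} (h : |Real.sin y| ≤ ε / 2) :
    ∃ n : ℤ, |y - n * Real.pi| ≤ ε := by
  have hpi := Real.pi_pos
  refine ⟨round (y / Real.pi), ?_⟩
  set n := round (y / Real.pi) with hn
  have h1 : |y / Real.pi - n| ≤ 1 / 2 := abs_sub_round _
  have h2 : y - n * Real.pi = (y / Real.pi - n) * Real.pi := by field_simp
  have h3 : |y - n * Real.pi| ≤ Real.pi / 2 := by
    rw [h2, abs_mul, abs_of_pos hpi]; nlinarith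
  have h4 := Real.mul_abs_le_abs_sin h3
  rw [Real.sin_sub_int_mul_pi, abs_mul, abs_zpow, abs_neg, abs_one, one_zpow, one_mul] at h4
  have h5 := h4.trans h
  rw [div_mul_eq_mul_div, div_le_iff₀ hpi] at h5
  have h6 := Real.pi_le_four
  have : 0 ≤ ε := by linarith [abs_nonneg (Real.sin y)]
  nlinarith

/-- The case of `abs_zero_gap_sub_le_of_cos` in which the phase is shifted so as to be near `0` at
the left zero. -/
theorem abs_zero_gap_sub_le_of_sin {y y' r r' : ℝ → ℝ} {a b N κ ε : ℝ} (hab : a < b) (hN : 0 < N)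
    (hκ : 0 ≤ κ) (hκ' : κ ≤ 1 / 2) (hε : 0 < ε) (hε' : ε ≤ 1 / 100)
    (hy : ∀ x ∈ Set.Icc a b, HasDerivAt y (y' x) x)
    (hy' : ∀ x ∈ Set.Icc a b, |y' x + N| ≤ κ * N)
    (hr : ∀ x ∈ Set.Icc a b, HasDerivAt r (r' x) x)
    (hrε : ∀ x ∈ Set.Icc a b, |r x| ≤ ε) (hr' : ∀ x ∈ Set.Icc a b, |r' x| ≤ 12 * ε * N)
    (ha : 2 * Real.sin (y a) + r a = 0) (hb : 2 * Real.sin (y b) + r b = 0)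
    (hya : |y a| ≤ ε)
    (hne : ∀ x ∈ Set.Ioo a b, 2 * Real.sin (y x) + r x ≠ 0) :
    |b - a - Real.pi / N| ≤ 7 * (κ + ε) / N := by
  have hpi := Real.pi_gt_three
  have hpi4 := Real.pi_lt_d2
  obtain ⟨hya1, hya2⟩ := abs_le.1 hya
  have hyc : ContinuousOn y (Set.Icc a b) := fun x hx => (hy x hx).continuousAt.continuousWithinAt
  have hgd : ∀ x ∈ Set.Icc a b, HasDerivAt (fun t => 2 * Real.sin (y t) + r t)
      (2 * (Real.cos (y x) * y' x) + r' x) x := fun x hx =>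
    (((hy x hx).sin).const_mul 2).add (hr x hx)
  have hgc : ContinuousOn (fun t => 2 * Real.sin (y t) + r t) (Set.Icc a b) := fun x hx =>
    (hgd x hx).continuousAt.continuousWithinAt
  have hneg : ∀ x ∈ Set.Icc a b, y' x ≤ -(N / 2) := by
    intro x hx
    have := (abs_le.1 (hy' x hx)).2
    nlinarith
  have hanti : AntitoneOn y (Set.Icc a b) := by
    apply antitoneOn_of_deriv_nonpos (convex_Icc a b) hyc
    · exact fun x hx => (hy x (interior_subset hx)).differentiableAt.differentiableWithinAt
    · intro x hx
      rw [(hy x (interior_subset hx)).deriv]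
      linarith [hneg x (interior_subset hx)]
  -- the phase cannot drop past `-π`, since there would be a further sign change
  have hupper : -Real.pi - 2 * ε ≤ y b := by
    by_contra! hcon
    obtain ⟨x₁, hx₁, hyx₁⟩ : -(Real.pi / 2) ∈ y '' Set.Ioo a b :=
      intermediate_value_Ioo' hab.le hyc ⟨by linarith, by linarith⟩
    obtain ⟨x₂, hx₂, hyx₂⟩ : -Real.pi - 2 * ε ∈ y '' Set.Ioo x₁ b :=
      intermediate_value_Ioo' hx₁.2.le
        (hyc.mono (Set.Icc_subset_Icc_left hx₁.1.le)) ⟨hcon, by linarith⟩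
    have hm1 : x₁ ∈ Set.Icc a b := Set.Ioo_subset_Icc_self hx₁
    have hm2 : x₂ ∈ Set.Icc a b := ⟨hx₁.1.le.trans hx₂.1.le, hx₂.2.le⟩
    have hg1 : 2 * Real.sin (y x₁) + r x₁ < 0 := by
      rw [hyx₁, Real.sin_neg, Real.sin_pi_div_two]
      linarith [(abs_le.1 (hrε x₁ hm1)).2]
    have hs : 2 / Real.pi * (2 * ε) ≤ Real.sin (2 * ε) :=
      Real.mul_le_sin (by linarith) (by linarith)
    have hs' : ε < 2 * Real.sin (2 * ε) := by
      have h8 : 1 / 2 ≤ 2 / Real.pi := by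
        rw [div_le_div_iff₀ (by norm_num) (by linarith)]; linarith
      nlinarith
    have hg2 : 0 < 2 * Real.sin (y x₂) + r x₂ := by
      rw [hyx₂, show -Real.pi - 2 * ε = -(2 * ε + Real.pi) by ring, Real.sin_neg, Real.sin_add_pi]
      linarith [(abs_le.1 (hrε x₂ hm2)).1]
    obtain ⟨x₃, hx₃, h0⟩ := intermediate_value_Ioo hx₂.1.le
      (hgc.mono (Set.Icc_subset_Icc hm1.1 hm2.2)) ⟨hg1, hg2⟩
    exact hne x₃ ⟨hx₁.1.trans hx₃.1, hx₃.2.trans hx₂.2⟩ h0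
  -- the phase cannot stay near `0`, since there the function is strictly monotone
  have hlower : y b ≤ -Real.pi + ε := by
    by_contra! hcon
    have hba : y b ≤ y a := hanti (Set.left_mem_Icc.2 hab.le) (Set.right_mem_Icc.2 hab.le) hab.le
    obtain ⟨n, hn⟩ := exists_abs_sub_int_mul_pi_le (y := y b) (ε := ε) (by
      rw [show Real.sin (y b) = -(r b) / 2 by linarith, abs_div, abs_neg, abs_two]
      linarith [hrε b (Set.right_mem_Icc.2 hab.le)])
    obtain ⟨hn1, hn2⟩ := abs_le.1 hn
    have hn0 : n = 0 := by
      have h1 : (-1 : ℝ) < n := by nlinarith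
      have h2 : (n : ℝ) < 1 := by nlinarith
      have h1' : (-1 : ℤ) < n := by exact_mod_cast h1
      have h2' : n < (1 : ℤ) := by exact_mod_cast h2
      omega
    rw [hn0] at hn1
    simp only [Int.cast_zero, zero_mul, sub_zero] at hn1
    obtain ⟨x, hx, hx0⟩ := exists_hasDerivAt_eq_zero hab hgc (by rw [ha, hb])
      (fun x hx => hgd x (Set.Ioo_subset_Icc_self hx))
    have hxm : x ∈ Set.Icc a b := Set.Ioo_subset_Icc_self hx
    have hyx1 : y x ≤ ε := (hanti (Set.left_mem_Icc.2 hab.le) hxm hx.1.le).trans hya2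
    have hyx2 : -ε ≤ y x := hn1.trans (hanti hxm (Set.right_mem_Icc.2 hab.le) hx.2.le)
    have hcos : 1 / 2 ≤ Real.cos (y x) := by
      have := Real.one_sub_sq_div_two_le_cos (x := y x)
      nlinarith
    have h1 := hneg x hxm
    have h2 := (abs_le.1 (hr' x hxm)).2
    nlinarith
  obtain ⟨z, hz, hz'⟩ := exists_hasDerivAt_eq_slope y y' hab hyc
    (fun x hx => hy x (Set.Ioo_subset_Icc_self hx))
  have hslope : y b - y a = y' z * (b - a) := by
    rw [hz']; field_simp [sub_ne_zero.2 hab.ne']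
  obtain ⟨h1, h2⟩ := abs_le.1 (hy' z (Set.Ioo_subset_Icc_self hz))
  have hd : 0 < b - a := by linarith
  have hNd : N * (b - a) ≤ 7 := by nlinarith
  have hup : N * (b - a) - Real.pi ≤ 7 * (κ + ε) := by nlinarith
  have hlo : -(7 * (κ + ε)) ≤ N * (b - a) - Real.pi := by nlinarith
  rw [show b - a - Real.pi / N = (N * (b - a) - Real.pi) / N by field_simp, abs_div, abs_of_pos hN]
  gcongr
  exact abs_le.2 ⟨hlo, hup⟩

/-- Spacing of consecutive zeros of `2 cos θ + r`, when the phase `θ` decreases at a rate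
close to `N` and the perturbation `r` and its derivative are small. -/
theorem abs_zero_gap_sub_le_of_cos {θ θ' r r' : ℝ → ℝ} {a b N κ ε : ℝ} (hab : a < b) (hN : 0 < N)
    (hκ : 0 ≤ κ) (hκ' : κ ≤ 1 / 2) (hε : 0 < ε) (hε' : ε ≤ 1 / 100)
    (hθ : ∀ x ∈ Set.Icc a b, HasDerivAt θ (θ' x) x)
    (hθ' : ∀ x ∈ Set.Icc a b, |θ' x + N| ≤ κ * N)
    (hr : ∀ x ∈ Set.Icc a b, HasDerivAt r (r' x) x)
    (hrε : ∀ x ∈ Set.Icc a b, |r x| ≤ ε) (hr' : ∀ x ∈ Set.Icc a b, |r' x| ≤ 12 * ε * N)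
    (ha : 2 * Real.cos (θ a) + r a = 0) (hb : 2 * Real.cos (θ b) + r b = 0)
    (hne : ∀ x ∈ Set.Ioo a b, 2 * Real.cos (θ x) + r x ≠ 0) :
    |b - a - Real.pi / N| ≤ 7 * (κ + ε) / N := by
  obtain ⟨m, hm⟩ := exists_abs_sub_int_mul_pi_le (y := θ a + Real.pi / 2) (ε := ε) (by
    rw [Real.sin_add_pi_div_two, show Real.cos (θ a) = -(r a) / 2 by linarith, abs_div, abs_neg,
      abs_two]
    linarith [hrε a (Set.left_mem_Icc.2 hab.le)])
  have hσ : |(-1 : ℝ) ^ m| = 1 := by rw [abs_zpow, abs_neg, abs_one, one_zpow]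
  have hσ0 : (-1 : ℝ) ^ m ≠ 0 := zpow_ne_zero _ (by norm_num)
  have hsin : ∀ x, 2 * Real.sin (θ x + Real.pi / 2 - m * Real.pi) + (-1) ^ m * r x =
      (-1) ^ m * (2 * Real.cos (θ x) + r x) := by
    intro x
    rw [Real.sin_sub_int_mul_pi, Real.sin_add_pi_div_two]; ring
  refine abs_zero_gap_sub_le_of_sin (y := fun x => θ x + Real.pi / 2 - m * Real.pi) (y' := θ')
    (r := fun x => (-1) ^ m * r x) (r' := fun x => (-1) ^ m * r' x)
    hab hN hκ hκ' hε hε' ?_ hθ' ?_ ?_ ?_ ?_ ?_ hm ?_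
  · exact fun x hx => ((hθ x hx).add_const _).sub_const _
  · exact fun x hx => (hr x hx).const_mul _
  · intro x hx; rw [abs_mul, hσ, one_mul]; exact hrε x hx
  · intro x hx; rw [abs_mul, hσ, one_mul]; exact hr' x hx
  · rw [hsin, ha, mul_zero]
  · rw [hsin, hb, mul_zero]
  · intro x hx
    rw [hsin]
    exact mul_ne_zero hσ0 (hne x hx)

/-! ### The gamma factors off the real axis -/

/-- The quotient `|Γ(a + i y)| / |Γ(b + i y)|` is largest on the real axis, as
`Γ(u) Γ(b - a) / Γ(u + b - a)` is a beta integral. -/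
theorem norm_Gamma_mul_Gamma_le {a b : ℝ} (ha : 0 < a) (hab : a < b) (y : ℝ) :
    ‖Gamma (a + y * I)‖ * Real.Gamma b ≤ Real.Gamma a * ‖Gamma (b + y * I)‖ := by
  have hd : 0 < b - a := by linarith
  have hb : 0 < b := by linarith
  have h1 := betaIntegral_eq_Gamma_mul_div (a + y * I) ((b - a : ℝ) : ℂ) (by simpa using ha)
    (by simpa using hab)
  have h2 := betaIntegral_eq_Gamma_mul_div (a : ℂ) ((b - a : ℝ) : ℂ) (by simpa using ha)
    (by simpa using hab)
  have hle : ‖betaIntegral (a + y * I) ((b - a : ℝ) : ℂ)‖ ≤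
      ‖betaIntegral (a : ℂ) ((b - a : ℝ) : ℂ)‖ := by
    have h3 : betaIntegral (a : ℂ) ((b - a : ℝ) : ℂ) =
        ((∫ x in (0 : ℝ)..1, x ^ (a - 1) * (1 - x) ^ (b - a - 1) : ℝ) : ℂ) := by
      rw [betaIntegral, ← intervalIntegral.integral_ofReal]
      apply intervalIntegral.integral_congr
      intro x hx
      rw [Set.uIcc_of_le zero_le_one] at hx
      simp only
      rw [ofReal_mul, ofReal_cpow hx.1, ofReal_cpow (by linarith [hx.2])]
      push_cast; rfl
    rw [h3, norm_real]
    refine le_trans (intervalIntegral.norm_integral_le_integral_norm zero_le_one) (le_trans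
      (le_of_eq ?_) (le_abs_self _))
    apply intervalIntegral.integral_congr_ae
    have : ∀ᵐ x : ℝ, x ≠ 1 := by
      simp [MeasureTheory.ae_iff, MeasureTheory.measure_singleton]
    filter_upwards [this] with x hx1 hx
    rw [Set.uIoc_of_le zero_le_one] at hx
    have hx' : 0 < 1 - x := by
      have := lt_of_le_of_ne hx.2 hx1
      linarith
    rw [norm_mul, norm_cpow_eq_rpow_re_of_pos hx.1,
      show (1 : ℂ) - x = ((1 - x : ℝ) : ℂ) by push_cast; ring,
      norm_cpow_eq_rpow_re_of_pos hx']
    simp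
  rw [h1, h2, show (a : ℂ) + y * I + ((b - a : ℝ) : ℂ) = b + y * I by push_cast; ring,
    show (a : ℂ) + ((b - a : ℝ) : ℂ) = (b : ℂ) by push_cast; ring, norm_div, norm_div, norm_mul,
    norm_mul, Gamma_ofReal, Gamma_ofReal, Gamma_ofReal, norm_real, norm_real, norm_real,
    Real.norm_of_nonneg (Real.Gamma_pos_of_pos hd).le,
    Real.norm_of_nonneg (Real.Gamma_pos_of_pos ha).le,
    Real.norm_of_nonneg (Real.Gamma_pos_of_pos hb).le] at hle
  have hg : 0 < ‖Gamma (b + y * I)‖ :=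
    norm_pos_iff.2 (Gamma_ne_zero_of_re_pos (by simpa using hb))
  rw [div_le_div_iff₀ hg (Real.Gamma_pos_of_pos hb)] at hle
  have := Real.Gamma_pos_of_pos hd
  nlinarith

theorem norm_Gamma_le_norm_Gamma_add_nat {z : ℂ} (hz : 1 ≤ |z.im|) (n : ℕ) :
    ‖Gamma z‖ ≤ ‖Gamma (z + n)‖ := by
  induction n with
  | zero => simp
  | succ n ih =>
    have h0 : z + n ≠ 0 := by
      intro h
      have := congrArg Complex.im h
      simp only [add_im, natCast_im, add_zero, zero_im] at this
      rw [this] at hz; norm_num at hz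
    rw [Nat.cast_succ, ← add_assoc, Gamma_add_one _ h0, norm_mul]
    have h1 : 1 ≤ ‖z + n‖ := hz.trans (by simpa using abs_im_le_norm (z + n))
    nlinarith [norm_nonneg (Gamma (z + n))]

theorem norm_Gamma_add_nat_le {z : ℂ} {A : ℝ} (n : ℕ) (hz : z.im ≠ 0)
    (hA : ‖z‖ + n ≤ A) : ‖Gamma (z + n)‖ ≤ A ^ n * ‖Gamma z‖ := by
  have key : ∀ m ≤ n, ‖Gamma (z + m)‖ ≤ A ^ m * ‖Gamma z‖ := by
    intro m
    induction m with
    | zero => simp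
    | succ m ih =>
      intro hm
      have h0 : z + m ≠ 0 := by
        intro h
        have := congrArg Complex.im h
        simp only [add_im, natCast_im, add_zero, zero_im] at this
        exact hz this
      have h1 : ‖z + m‖ ≤ A := by
        refine (norm_add_le _ _).trans ?_
        rw [norm_natCast]
        have : (m : ℝ) ≤ n := by exact_mod_cast (by omega : m ≤ n)
        linarith
      rw [Nat.cast_succ, ← add_assoc, Gamma_add_one _ h0, norm_mul, pow_succ']
      have h2 := ih (by omega)
      rw [mul_assoc]
      exact mul_le_mul h1 h2 (norm_nonneg _) ((norm_nonneg _).trans h1)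
  exact key n le_rfl

/-- Values of `Γ` at the same height differ by a power of the height. Both arguments are first moved
to the right by integers, so that they are positive and in the order that
`norm_Gamma_mul_Gamma_le` requires. -/
theorem norm_Gamma_le_mul_norm_Gamma {x₁ x₂ y : ℝ} (h₁ : x₁ ∈ Set.Icc (-1) 2)
    (h₂ : x₂ ∈ Set.Icc (-1) 2) (hy : 1 ≤ |y|) :
    ‖Gamma (x₁ + y * I)‖ ≤ 120 * (9 * |y|) ^ 6 * ‖Gamma (x₂ + y * I)‖ := by
  obtain ⟨h11, h12⟩ := h₁
  obtain ⟨h21, h22⟩ := h₂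
  have hA := norm_Gamma_le_norm_Gamma_add_nat (z := x₁ + y * I) (by simpa using hy) 2
  have hB := norm_Gamma_add_nat_le (z := x₂ + y * I) (A := 9 * |y|) 6
    (by
      intro h
      simp only [add_im, ofReal_im, mul_im, ofReal_re, I_im, mul_one, I_re, mul_zero, add_zero,
        zero_add] at h
      rw [h] at hy; norm_num at hy)
    (by
      have h3 := norm_le_abs_re_add_abs_im (x₂ + y * I)
      simp only [add_re, ofReal_re, mul_re, I_re, mul_zero, ofReal_im, I_im, mul_one, sub_self,
        add_zero, add_im, mul_im, zero_add] at h3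
      have h4 : |x₂| ≤ 2 := abs_le.2 ⟨by linarith, h22⟩
      push_cast
      linarith)
  have hC := norm_Gamma_mul_Gamma_le (a := x₁ + 2) (b := x₂ + 6) (by linarith) (by linarith) y
  have e1 : ((x₁ + 2 : ℝ) : ℂ) + y * I = x₁ + y * I + (2 : ℕ) := by push_cast; ring
  have e2 : ((x₂ + 6 : ℝ) : ℂ) + y * I = x₂ + y * I + (6 : ℕ) := by push_cast; ring
  rw [e1, e2] at hC
  have hG2 : 1 ≤ Real.Gamma (x₂ + 6) := by
    rw [← Real.Gamma_two]
    exact Real.Gamma_strictMonoOn_Ici.monotoneOn (by simp) (by simp; linarith) (by linarith)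
  have hG1 : Real.Gamma (x₁ + 2) ≤ 120 := by
    have h5 : Real.Gamma (x₁ + 4) ≤ 120 := by
      have h6 : Real.Gamma 6 = 120 := by
        have := Real.Gamma_nat_eq_factorial 5
        rw [show ((5 : ℕ) : ℝ) + 1 = 6 by norm_num] at this
        rw [this]
        norm_num [Nat.factorial]
      rw [← h6]
      exact Real.Gamma_strictMonoOn_Ici.monotoneOn (by simp; linarith) (by simp; norm_num)
        (by linarith)
    have h7 : Real.Gamma (x₁ + 4) = (x₁ + 3) * ((x₁ + 2) * Real.Gamma (x₁ + 2)) := by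
      rw [← Real.Gamma_add_one (by linarith), show x₁ + 4 = (x₁ + 2 + 1) + 1 by ring,
        Real.Gamma_add_one (by linarith)]
      ring
    have h8 := Real.Gamma_pos_of_pos (show 0 < x₁ + 2 by linarith)
    nlinarith [mul_nonneg (show 0 ≤ x₁ + 1 by linarith) h8.le,
      mul_nonneg (mul_nonneg (show 0 ≤ x₁ + 1 by linarith) (show 0 ≤ x₁ + 1 by linarith)) h8.le]
  set u := ‖Gamma (x₁ + y * I + (2 : ℕ))‖
  set v := ‖Gamma (x₂ + y * I + (6 : ℕ))‖
  have hu : u ≤ 120 * v := by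
    have : 0 ≤ u := norm_nonneg _
    have : 0 ≤ v := norm_nonneg _
    nlinarith
  calc _ ≤ u := hA
    _ ≤ 120 * v := hu
    _ ≤ 120 * ((9 * |y|) ^ 6 * ‖Gamma (x₂ + y * I)‖) := by gcongr
    _ = _ := by ring

theorem Gammaℝ_ne_zero_of_im_ne_zero {s : ℂ} (hs : s.im ≠ 0) : Gammaℝ s ≠ 0 := by
  intro h
  obtain ⟨n, hn⟩ := Gammaℝ_eq_zero_iff.1 h
  exact hs (by rw [hn]; simp)

theorem differentiableAt_Gammaℝ {s : ℂ} (hs : s.im ≠ 0) : DifferentiableAt ℂ Gammaℝ s := by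
  have h := (differentiable_Gammaℝ_inv s).inv (inv_ne_zero (Gammaℝ_ne_zero_of_im_ne_zero hs))
  simpa [Pi.inv_def] using! h

theorem gammaFactor_eq_Gammaℝ {k : ℕ} (ψ : DirichletCharacter ℂ k) :
    ∃ a : ℝ, (a = 0 ∨ a = 1) ∧ ∀ s, ψ.gammaFactor s = Gammaℝ (s + a) := by
  rcases ψ.even_or_odd with h | h
  · exact ⟨0, Or.inl rfl, fun s => by simp [h.gammaFactor_def]⟩
  · exact ⟨1, Or.inr rfl, fun s => by simp [h.gammaFactor_def]⟩

theorem gammaFactor_ne_zero {k : ℕ} (ψ : DirichletCharacter ℂ k) {s : ℂ} (hs : s.im ≠ 0) :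
    ψ.gammaFactor s ≠ 0 := by
  obtain ⟨a, -, h⟩ := gammaFactor_eq_Gammaℝ ψ
  rw [h]
  exact Gammaℝ_ne_zero_of_im_ne_zero (by simpa using hs)

theorem differentiableAt_gammaFactor {k : ℕ} (ψ : DirichletCharacter ℂ k) {s : ℂ}
    (hs : s.im ≠ 0) : DifferentiableAt ℂ ψ.gammaFactor s := by
  obtain ⟨a, -, h⟩ := gammaFactor_eq_Gammaℝ ψ
  rw [show ψ.gammaFactor = fun s => Gammaℝ (s + a) from funext h]
  exact ((differentiableAt_Gammaℝ (s := s + a) (by simpa using hs)).hasDerivAt.comp_add_const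
    s (a : ℂ)).differentiableAt

theorem norm_Gammaℝ (s : ℂ) : ‖Gammaℝ s‖ = Real.pi ^ (-s.re / 2) * ‖Gamma (s / 2)‖ := by
  rw [Gammaℝ_def, norm_mul, norm_cpow_eq_rpow_re_of_pos Real.pi_pos]
  congr 2
  rw [show (2 : ℂ) = ((2 : ℝ) : ℂ) by simp, div_ofReal_re, neg_re]

theorem norm_Gammaℝ_conj (s : ℂ) : ‖Gammaℝ (starRingEnd ℂ s)‖ = ‖Gammaℝ s‖ := by
  rw [norm_Gammaℝ, norm_Gammaℝ, conj_re,
    show starRingEnd ℂ s / 2 = starRingEnd ℂ (s / 2) by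
      rw [map_div₀, Complex.conj_ofNat], Gamma_conj, norm_conj]

theorem norm_gammaFactor_conj {k : ℕ} (ψ : DirichletCharacter ℂ k) (s : ℂ) :
    ‖ψ.gammaFactor (starRingEnd ℂ s)‖ = ‖ψ.gammaFactor s‖ := by
  obtain ⟨a, -, h⟩ := gammaFactor_eq_Gammaℝ ψ
  rw [h, h, ← norm_Gammaℝ_conj (s + a)]
  simp

theorem norm_Gammaℝ_le_mul {x₁ x₂ t : ℝ} (h₁ : x₁ ∈ Set.Icc (-1) 3) (h₂ : x₂ ∈ Set.Icc (-1) 3)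
    (ht : 2 ≤ t) :
    ‖Gammaℝ (x₁ + t * I)‖ ≤ 16 * (120 * (9 * t) ^ 6) * ‖Gammaℝ (x₂ + t * I)‖ := by
  obtain ⟨h11, h12⟩ := h₁
  obtain ⟨h21, h22⟩ := h₂
  have hG := norm_Gamma_le_mul_norm_Gamma (x₁ := x₁ / 2) (x₂ := x₂ / 2) (y := t / 2)
    ⟨by linarith, by linarith⟩ ⟨by linarith, by linarith⟩
    (by rw [abs_of_nonneg (by linarith)]; linarith)
  rw [abs_of_nonneg (by linarith)] at hG
  have e : ∀ x : ℝ, ((x : ℂ) + t * I) / 2 = ((x / 2 : ℝ) : ℂ) + ((t / 2 : ℝ) : ℂ) * I := by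
    intro x; push_cast; ring
  have hre : ∀ x : ℝ, ((x : ℂ) + t * I).re = x := by intro x; simp
  rw [norm_Gammaℝ, norm_Gammaℝ, e, e, hre, hre]
  have hpi : Real.pi ^ (-x₁ / 2) ≤ 16 * Real.pi ^ (-x₂ / 2) := by
    have h3 : Real.pi ^ (-x₁ / 2) = Real.pi ^ ((x₂ - x₁) / 2) * Real.pi ^ (-x₂ / 2) := by
      rw [← Real.rpow_add Real.pi_pos]; congr 1; ring
    rw [h3]
    have h4 : Real.pi ^ ((x₂ - x₁) / 2) ≤ Real.pi ^ (2 : ℝ) :=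
      Real.rpow_le_rpow_of_exponent_le (by linarith [Real.pi_gt_three]) (by linarith)
    have h5 : Real.pi ^ (2 : ℝ) ≤ 16 := by
      rw [Real.rpow_two]; nlinarith [Real.pi_le_four, Real.pi_pos]
    have := Real.rpow_pos_of_pos Real.pi_pos (-x₂ / 2)
    nlinarith
  have hmono : (9 * (t / 2)) ^ 6 ≤ (9 * t) ^ 6 := by gcongr; linarith
  set u := ‖Gamma (((x₁ / 2 : ℝ) : ℂ) + ((t / 2 : ℝ) : ℂ) * I)‖
  set v := ‖Gamma (((x₂ / 2 : ℝ) : ℂ) + ((t / 2 : ℝ) : ℂ) * I)‖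
  calc Real.pi ^ (-x₁ / 2) * u ≤ (16 * Real.pi ^ (-x₂ / 2)) * (120 * (9 * t) ^ 6 * v) := by
        apply mul_le_mul hpi (hG.trans ?_) (norm_nonneg _) (by positivity)
        gcongr
    _ = _ := by ring

/-- The quotient of gamma factors in the functional equation. -/
noncomputable def gammaQuot {k : ℕ} (ψ : DirichletCharacter ℂ k) (s : ℂ) : ℂ :=
  ψ.gammaFactor (1 - s) / ψ.gammaFactor s

theorem gammaQuot_ne_zero {k : ℕ} (ψ : DirichletCharacter ℂ k) {s : ℂ} (hs : s.im ≠ 0) :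
    gammaQuot ψ s ≠ 0 :=
  div_ne_zero (gammaFactor_ne_zero ψ (by simpa using hs)) (gammaFactor_ne_zero ψ hs)

theorem differentiableAt_gammaQuot {k : ℕ} (ψ : DirichletCharacter ℂ k) {s : ℂ}
    (hs : s.im ≠ 0) : DifferentiableAt ℂ (gammaQuot ψ) s := by
  have h1 : DifferentiableAt ℂ (fun s => ψ.gammaFactor (1 - s)) s :=
    DifferentiableAt.comp (g := ψ.gammaFactor) s
      (differentiableAt_gammaFactor ψ (by simpa using hs)) (by fun_prop)
  exact h1.div (differentiableAt_gammaFactor ψ hs) (gammaFactor_ne_zero ψ hs)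

theorem abs_log_norm_gammaQuot_le {k : ℕ} (ψ : DirichletCharacter ℂ k) {s : ℂ}
    (h1 : -1 / 2 ≤ s.re) (h2 : s.re ≤ 3 / 2) (ht : 2 ≤ s.im) :
    |Real.log ‖gammaQuot ψ s‖| ≤ Real.log (16 * (120 * (9 * s.im) ^ 6)) := by
  have him : s.im ≠ 0 := by linarith
  obtain ⟨a, ha, h⟩ := gammaFactor_eq_Gammaℝ ψ
  have ha0 : 0 ≤ a ∧ a ≤ 1 := by rcases ha with rfl | rfl <;> norm_num
  have e1 : ‖ψ.gammaFactor (1 - s)‖ = ‖Gammaℝ ((1 - s.re + a : ℝ) + s.im * I)‖ := by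
    rw [h, ← norm_Gammaℝ_conj]
    congr 2
    apply Complex.ext <;> simp
  have e2 : ‖ψ.gammaFactor s‖ = ‖Gammaℝ ((s.re + a : ℝ) + s.im * I)‖ := by
    rw [h]
    congr 2
    apply Complex.ext <;> simp
  have p1 : 0 < ‖ψ.gammaFactor (1 - s)‖ :=
    norm_pos_iff.2 (gammaFactor_ne_zero ψ (by simpa using him))
  have p2 : 0 < ‖ψ.gammaFactor s‖ := norm_pos_iff.2 (gammaFactor_ne_zero ψ him)
  have m1 : 1 - s.re + a ∈ Set.Icc (-1 : ℝ) 3 := ⟨by linarith, by linarith⟩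
  have m2 : s.re + a ∈ Set.Icc (-1 : ℝ) 3 := ⟨by linarith, by linarith⟩
  have b1 := norm_Gammaℝ_le_mul m1 m2 ht
  have b2 := norm_Gammaℝ_le_mul m2 m1 ht
  rw [← e1, ← e2] at b1 b2
  have hA : 0 < 16 * (120 * (9 * s.im) ^ 6) := by
    have : 0 < s.im := by linarith
    positivity
  rw [gammaQuot, norm_div, Real.log_div p1.ne' p2.ne']
  have l1 := Real.log_le_log p1 b1
  have l2 := Real.log_le_log p2 b2
  rw [Real.log_mul hA.ne' p2.ne'] at l1
  rw [Real.log_mul hA.ne' p1.ne'] at l2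
  exact abs_le.2 ⟨by linarith, by linarith⟩

/-- The weak form `O(log t)` of Stirling's formula for the logarithmic derivative. -/
theorem norm_logDeriv_gammaQuot_le {k : ℕ} (ψ : DirichletCharacter ℂ k) {s : ℂ}
    (h1 : 0 ≤ s.re) (h2 : s.re ≤ 1) (ht : 3 ≤ s.im) :
    ‖logDeriv (gammaQuot ψ) s‖ ≤ 1000 * Real.log s.im := by
  have hball : ∀ z ∈ Metric.ball s (1 / 2),
      -1 / 2 ≤ z.re ∧ z.re ≤ 3 / 2 ∧ 2 ≤ z.im ∧ z.im ≤ 2 * s.im := by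
    intro z hz
    rw [Metric.mem_ball, dist_eq_norm] at hz
    have hr := abs_le.1 ((abs_re_le_norm (z - s)).trans hz.le)
    have hi := abs_le.1 ((abs_im_le_norm (z - s)).trans hz.le)
    rw [sub_re] at hr
    rw [sub_im] at hi
    refine ⟨?_, ?_, ?_, ?_⟩ <;> linarith [hr.1, hr.2, hi.1, hi.2]
  set B := Real.log (16 * (120 * (18 * s.im) ^ 6)) with hB
  have hlog : 1 ≤ Real.log s.im := by
    rw [Real.le_log_iff_exp_le (by linarith)]
    linarith [Real.exp_one_lt_d9]
  have hBle : B ≤ 31 * Real.log s.im := by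
    have e : 16 * (120 * (18 * s.im) ^ 6) ≤ s.im ^ 31 := by
      have : (3 : ℝ) ^ 25 ≤ s.im ^ 25 := by gcongr
      calc 16 * (120 * (18 * s.im) ^ 6) = (16 * 120 * 18 ^ 6) * s.im ^ 6 := by ring
        _ ≤ s.im ^ 25 * s.im ^ 6 := by gcongr; norm_num at this ⊢; linarith
        _ = _ := by ring
    have := Real.log_le_log (by have : 0 < s.im := by linarith
                                positivity) e
    rw [Real.log_pow] at this
    exact_mod_cast this
  have hbd : ∀ z ∈ Metric.ball s (1 / 2), |Real.log ‖gammaQuot ψ z‖| ≤ B := by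
    intro z hz
    obtain ⟨a1, a2, a3, a4⟩ := hball z hz
    refine (abs_log_norm_gammaQuot_le ψ a1 a2 a3).trans ?_
    apply Real.log_le_log
    · have : 0 < z.im := by linarith
      positivity
    · gcongr 16 * (120 * ?_ ^ 6)
      linarith
  have hB0 : 0 < B := by
    apply Real.log_pos
    have : (3 : ℝ) ^ 6 ≤ s.im ^ 6 := by gcongr
    rw [mul_pow]
    nlinarith
  refine (norm_logDeriv_le_of_log_norm_mem (a := -B) (b := B) (by norm_num : (0 : ℝ) < 1 / 2)
    (by linarith) ?_ ?_ ?_ ?_).trans ?_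
  · intro z hz
    exact (differentiableAt_gammaQuot ψ
      (by linarith [(hball z hz).2.2.1])).differentiableWithinAt
  · intro z hz
    exact gammaQuot_ne_zero ψ (by linarith [(hball z hz).2.2.1])
  · exact fun z hz => (abs_le.1 (hbd z hz)).1
  · exact fun z hz => (abs_le.1 (hbd z hz)).2
  · have : 8 * (B - -B) / (1 / 2) = 32 * B := by ring
    rw [this]; linarith

/-! ### The functional equation on and near the critical line -/

theorem ne_one_of_isPrimitive {k : ℕ} [NeZero k] {ψ : DirichletCharacter ℂ k}
    (hψ : ψ.IsPrimitive) (hk : 1 < k) : ψ ≠ 1 := by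
  rintro rfl
  have h := (DirichletCharacter.isPrimitive_def _).1 hψ
  rw [DirichletCharacter.conductor_one] at h
  omega

theorem inv_apply_eq_conj {k : ℕ} [NeZero k] (ψ : DirichletCharacter ℂ k) (a : ZMod k) :
    ψ⁻¹ a = starRingEnd ℂ (ψ a) := by
  rw [starRingEnd_apply, MulChar.star_apply']

theorem conj_natCast_cpow (n : ℕ) (s : ℂ) :
    starRingEnd ℂ ((n : ℂ) ^ s) = (n : ℂ) ^ starRingEnd ℂ s := by
  rw [cpow_conj _ _ (by rw [natCast_arg]; exact Real.pi_pos.ne), conj_natCast]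

theorem LFunction_inv_conj {k : ℕ} [NeZero k] {ψ : DirichletCharacter ℂ k} (hψ : ψ ≠ 1) (s : ℂ) :
    ψ⁻¹.LFunction (starRingEnd ℂ s) = starRingEnd ℂ (ψ.LFunction s) := by
  have hψ' : ψ⁻¹ ≠ 1 := inv_ne_one.2 hψ
  have hd1 : Differentiable ℂ ψ⁻¹.LFunction := DirichletCharacter.differentiable_LFunction hψ'
  have hd2 : Differentiable ℂ (starRingEnd ℂ ∘ ψ.LFunction ∘ starRingEnd ℂ) := fun z => by
    have := (DirichletCharacter.differentiable_LFunction hψ (starRingEnd ℂ z)).conj_conj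
    simpa using this
  have heq : ψ⁻¹.LFunction = starRingEnd ℂ ∘ ψ.LFunction ∘ starRingEnd ℂ := by
    refine AnalyticOnNhd.eq_of_eventuallyEq (z₀ := 2) (fun z _ => hd1.analyticAt z)
      (fun z _ => hd2.analyticAt z) ?_
    have h : {z : ℂ | 1 < z.re} ∈ nhds (2 : ℂ) :=
      (isOpen_lt continuous_const continuous_re).mem_nhds (by simp)
    filter_upwards [h] with z hz
    have hz' : 1 < (starRingEnd ℂ z).re := by simpa using hz
    simp only [Function.comp]
    rw [ψ⁻¹.LFunction_eq_LSeries hz, ψ.LFunction_eq_LSeries hz', LSeries, LSeries, conj_tsum]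
    congr 1
    funext n
    rcases eq_or_ne n 0 with rfl | hn
    · simp
    · rw [LSeries.term_of_ne_zero hn, LSeries.term_of_ne_zero hn, map_div₀, conj_natCast_cpow,
        conj_conj, inv_apply_eq_conj]
  rw [heq]; simp

/-- The functional equation of a primitive character, with the reflection `s ↦ 1 - s̄` in the
critical line. -/
theorem LFunction_eq_Delta_mul_conj {k : ℕ} [NeZero k] {ψ : DirichletCharacter ℂ k}
    (hψ : ψ.IsPrimitive) (hk : 1 < k) {s : ℂ} (hs : s.im ≠ 0) :
    ψ.LFunction s = Delta ψ s * starRingEnd ℂ (ψ.LFunction (1 - starRingEnd ℂ s)) := by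
  rw [LFunction_eq_Delta_mul hψ hs, ← LFunction_inv_conj (ne_one_of_isPrimitive hψ hk)]
  simp

theorem norm_Delta_critical {k : ℕ} [NeZero k] (ψ : DirichletCharacter ℂ k) {s : ℂ}
    (hs : s.im ≠ 0) (hre : s.re = 1 / 2) : ‖Delta ψ s‖ = ‖ψ.rootNumber‖ := by
  have h1 : 1 - s = starRingEnd ℂ s := by
    apply Complex.ext
    · simp [hre]; norm_num
    · simp
  rw [Delta, norm_mul, norm_mul, norm_div, h1, norm_gammaFactor_conj,
    div_self (norm_ne_zero_iff.2 (gammaFactor_ne_zero ψ hs)), mul_one,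
    norm_natCast_cpow_of_pos (NeZero.pos k)]
  simp [hre]

/-- The root number has modulus `1`: compare the two sides of the functional equation at a point
of the critical line where `L(s, ψ)` is not zero. -/
theorem norm_rootNumber {k : ℕ} [NeZero k] {ψ : DirichletCharacter ℂ k}
    (hψ : ψ.IsPrimitive) (hk : 1 < k) : ‖ψ.rootNumber‖ = 1 := by
  have hψ1 := ne_one_of_isPrimitive hψ hk
  -- `L(s, ψ)` does not vanish identically on the critical line
  obtain ⟨s, hs, hre, h0⟩ : ∃ s : ℂ, s.im ≠ 0 ∧ s.re = 1 / 2 ∧ ψ.LFunction s ≠ 0 := by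
    by_contra! hcon
    have hd : Differentiable ℂ ψ.LFunction := DirichletCharacter.differentiable_LFunction hψ1
    have htend : Filter.Tendsto (fun t : ℝ => (1 / 2 + 2 * I : ℂ) + t * I) (nhdsWithin 0 {0}ᶜ)
        (nhdsWithin (1 / 2 + 2 * I) {1 / 2 + 2 * I}ᶜ) := by
      apply tendsto_nhdsWithin_of_tendsto_nhds_of_eventually_within
      · have : Continuous (fun t : ℝ => (1 / 2 + 2 * I : ℂ) + t * I) := by fun_prop
        have h := this.tendsto 0
        simp only [ofReal_zero, zero_mul, add_zero] at h
        exact h.mono_left nhdsWithin_le_nhds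
      · filter_upwards [self_mem_nhdsWithin] with t ht
        simpa using ht
    have hev : ∀ᶠ t : ℝ in nhdsWithin 0 {0}ᶜ,
        ψ.LFunction ((1 / 2 + 2 * I : ℂ) + t * I) =
          (fun _ => (0 : ℂ)) ((1 / 2 + 2 * I : ℂ) + t * I) := by
      have : Set.Ioi (-1 : ℝ) ∈ nhdsWithin (0 : ℝ) {0}ᶜ :=
        mem_nhdsWithin_of_mem_nhds (Ioi_mem_nhds (by norm_num))
      filter_upwards [this] with t ht
      apply hcon
      · have : -1 < t := ht
        simp; linarith
      · simp
    have h := AnalyticOnNhd.eq_of_frequently_eq (fun z _ => hd.analyticAt z)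
      (fun z _ => analyticAt_const) (htend.frequently hev.frequently)
    exact DirichletCharacter.LFunction_ne_zero_of_one_le_re ψ (s := 2) (Or.inl hψ1) (by simp)
      (congrFun h 2)
  have h := congrArg norm (LFunction_eq_Delta_mul_conj hψ hk hs)
  have h1 : 1 - starRingEnd ℂ s = s := by
    apply Complex.ext
    · simp [hre]; norm_num
    · simp
  rw [h1, norm_mul, norm_conj, norm_Delta_critical ψ hs hre] at h
  have := norm_pos_iff.2 h0
  exact (mul_eq_right₀ this.ne').1 h.symm

theorem Delta_eq_mul_gammaQuot {k : ℕ} [NeZero k] (ψ : DirichletCharacter ℂ k) (s : ℂ) :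
    Delta ψ s = ψ.rootNumber * (k : ℂ) ^ (1 / 2 - s) * gammaQuot ψ s := rfl

theorem Delta_ne_zero {k : ℕ} [NeZero k] {ψ : DirichletCharacter ℂ k}
    (hψ : ψ.IsPrimitive) (hk : 1 < k) {s : ℂ} (hs : s.im ≠ 0) : Delta ψ s ≠ 0 := by
  rw [Delta_eq_mul_gammaQuot]
  refine mul_ne_zero (mul_ne_zero ?_ ?_) (gammaQuot_ne_zero ψ hs)
  · rw [← norm_ne_zero_iff, norm_rootNumber hψ hk]; norm_num
  · simp [cpow_eq_zero_iff, NeZero.ne k]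

theorem hasDerivAt_Delta {k : ℕ} [NeZero k] (ψ : DirichletCharacter ℂ k) {s : ℂ}
    (hs : s.im ≠ 0) :
    HasDerivAt (Delta ψ) (Delta ψ s * (-Real.log k + logDeriv (gammaQuot ψ) s)) s := by
  have h1 : HasDerivAt (fun z : ℂ => (k : ℂ) ^ (1 / 2 - z)) _ s :=
    ((hasDerivAt_id s).const_sub (1 / 2)).const_cpow (Or.inl (NeZero.ne (k : ℂ)))
  have h2 := (h1.const_mul ψ.rootNumber).mul (differentiableAt_gammaQuot ψ hs).hasDerivAt
  refine (show HasDerivAt (Delta ψ) _ s from h2).congr_deriv ?_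
  rw [Delta_eq_mul_gammaQuot, logDeriv_apply, ← natCast_log]
  have := gammaQuot_ne_zero ψ hs
  field_simp
  simp only [id]
  ring

theorem logDeriv_Delta {k : ℕ} [NeZero k] {ψ : DirichletCharacter ℂ k}
    (hψ : ψ.IsPrimitive) (hk : 1 < k) {s : ℂ} (hs : s.im ≠ 0) :
    logDeriv (Delta ψ) s = -Real.log k + logDeriv (gammaQuot ψ) s := by
  rw [logDeriv_apply, (hasDerivAt_Delta ψ hs).deriv,
    mul_div_cancel_left₀ _ (Delta_ne_zero hψ hk hs)]

section Twist

variable {D q : ℕ} [NeZero D] [NeZero q] {χ : DirichletCharacter ℂ D} {ψ : DirichletCharacter ℂ q}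

/-- The functional equation of `L(s, ψ) L(s, ψχ)`; the two factors are reflected separately. -/
theorem LL_eq_Delta₁_mul_conj (hψ : ψ.IsPrimitive) (hψχ : (ψ.mul χ).IsPrimitive) (hq : 1 < q)
    {s : ℂ} (hs : s.im ≠ 0) :
    LL χ ψ s = Delta₁ χ ψ s * starRingEnd ℂ (LL χ ψ (1 - starRingEnd ℂ s)) := by
  have hk : 1 < Nat.lcm q D :=
    hq.trans_le (Nat.le_of_dvd (NeZero.pos _) (Nat.dvd_lcm_left q D))
  rw [LL, LL, Delta₁, LFunction_eq_Delta_mul_conj hψ hq hs,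
    LFunction_eq_Delta_mul_conj hψχ hk hs, map_mul]
  ring

theorem Delta₁_ne_zero (hψ : ψ.IsPrimitive) (hψχ : (ψ.mul χ).IsPrimitive) (hq : 1 < q)
    {s : ℂ} (hs : s.im ≠ 0) : Delta₁ χ ψ s ≠ 0 := by
  have hk : 1 < Nat.lcm q D :=
    hq.trans_le (Nat.le_of_dvd (NeZero.pos _) (Nat.dvd_lcm_left q D))
  exact mul_ne_zero (Delta_ne_zero hψ hq hs) (Delta_ne_zero hψχ hk hs)

theorem norm_Delta₁_critical (hψ : ψ.IsPrimitive) (hψχ : (ψ.mul χ).IsPrimitive) (hq : 1 < q)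
    {s : ℂ} (hs : s.im ≠ 0) (hre : s.re = 1 / 2) : ‖Delta₁ χ ψ s‖ = 1 := by
  have hk : 1 < Nat.lcm q D :=
    hq.trans_le (Nat.le_of_dvd (NeZero.pos _) (Nat.dvd_lcm_left q D))
  rw [Delta₁, norm_mul, norm_Delta_critical ψ hs hre, norm_Delta_critical (ψ.mul χ) hs hre,
    norm_rootNumber hψ hq, norm_rootNumber hψχ hk, one_mul]

theorem differentiableAt_Delta₁ (χ : DirichletCharacter ℂ D) (ψ : DirichletCharacter ℂ q)
    {s : ℂ} (hs : s.im ≠ 0) : DifferentiableAt ℂ (Delta₁ χ ψ) s :=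
  ((hasDerivAt_Delta ψ hs).differentiableAt).mul ((hasDerivAt_Delta (ψ.mul χ) hs).differentiableAt)

theorem differentiable_LL (hψ : ψ.IsPrimitive) (hψχ : (ψ.mul χ).IsPrimitive) (hq : 1 < q) :
    Differentiable ℂ (LL χ ψ) := by
  have hk : 1 < Nat.lcm q D :=
    hq.trans_le (Nat.le_of_dvd (NeZero.pos _) (Nat.dvd_lcm_left q D))
  exact (DirichletCharacter.differentiable_LFunction (ne_one_of_isPrimitive hψ hq)).mul
    (DirichletCharacter.differentiable_LFunction (ne_one_of_isPrimitive hψχ hk))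

/-- The main term is `-log q - log [q, D]`, and both `log q` and `log [q, D]` are `ℒ² + O(ℒ)`. -/
theorem norm_logDeriv_Delta₁_add_le (hψ : ψ.IsPrimitive) (hψχ : (ψ.mul χ).IsPrimitive)
    (hD : 3 ≤ D) (hq1 : bigQ D < q) (hq2 : (q : ℝ) < 2 * bigQ D)
    {s : ℂ} (h0 : 0 ≤ s.re) (h1 : s.re ≤ 1) (h3 : 3 ≤ s.im) (h2D : s.im ≤ 2 * D) :
    ‖logDeriv (Delta₁ χ ψ) s + 2 * (logD D : ℂ) ^ 2‖ ≤ 5000 * logD D := by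
  have hD' : (3 : ℝ) ≤ D := by exact_mod_cast hD
  have hL1 : 1 ≤ logD D := by
    rw [logD, Real.le_log_iff_exp_le (by linarith)]
    linarith [Real.exp_one_lt_d9]
  have hQ1 : 1 ≤ bigQ D := Real.one_le_exp (by positivity)
  have hq : 1 < q := by
    have : (1 : ℝ) < q := by linarith
    exact_mod_cast this
  have hk : 1 < Nat.lcm q D :=
    hq.trans_le (Nat.le_of_dvd (NeZero.pos _) (Nat.dvd_lcm_left q D))
  have hs : s.im ≠ 0 := by linarith
  rw [show logDeriv (Delta₁ χ ψ) s = logDeriv (Delta ψ) s + logDeriv (Delta (ψ.mul χ)) s from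
    logDeriv_mul s (Delta_ne_zero hψ hq hs) (Delta_ne_zero hψχ hk hs)
      (hasDerivAt_Delta ψ hs).differentiableAt (hasDerivAt_Delta (ψ.mul χ) hs).differentiableAt,
    logDeriv_Delta hψ hq hs, logDeriv_Delta hψχ hk hs]
  have hg1 := norm_logDeriv_gammaQuot_le ψ h0 h1 h3
  have hg2 := norm_logDeriv_gammaQuot_le (ψ.mul χ) h0 h1 h3
  have hlog2 := Real.log_two_lt_d9
  have him : Real.log s.im ≤ 2 * logD D := by
    have h4 : Real.log s.im ≤ Real.log (2 * D) := Real.log_le_log (by linarith) h2D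
    rw [Real.log_mul (by norm_num) (by linarith)] at h4
    rw [logD] at hL1 ⊢; linarith
  have hlogQ : Real.log (bigQ D) = logD D ^ 2 := Real.log_exp _
  have hq3 : logD D ^ 2 ≤ Real.log q := by
    rw [← hlogQ]; exact Real.log_le_log (by linarith) hq1.le
  have hq4 : Real.log q ≤ logD D ^ 2 + 1 := by
    have h4 : Real.log q ≤ Real.log (2 * bigQ D) := Real.log_le_log (by linarith) hq2.le
    rw [Real.log_mul (by norm_num) (by linarith), hlogQ] at h4
    linarith
  have hl1 : Real.log q ≤ Real.log (Nat.lcm q D : ℕ) := by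
    apply Real.log_le_log (by linarith)
    exact_mod_cast Nat.le_of_dvd (NeZero.pos _) (Nat.dvd_lcm_left q D)
  have hl2 : Real.log (Nat.lcm q D : ℕ) ≤ Real.log q + logD D := by
    rw [logD, ← Real.log_mul (by linarith) (by linarith)]
    apply Real.log_le_log (by exact_mod_cast NeZero.pos _)
    exact_mod_cast Nat.le_of_dvd (Nat.mul_pos (NeZero.pos _) (NeZero.pos _)) (Nat.lcm_dvd_mul q D)
  have e : (-(Real.log q : ℂ) + logDeriv (gammaQuot ψ) s +
      (-(Real.log (Nat.lcm q D : ℕ) : ℂ) + logDeriv (gammaQuot (ψ.mul χ)) s) +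
        2 * (logD D : ℂ) ^ 2) =
      ((2 * logD D ^ 2 - Real.log q - Real.log (Nat.lcm q D : ℕ) : ℝ) : ℂ) +
        (logDeriv (gammaQuot ψ) s + logDeriv (gammaQuot (ψ.mul χ)) s) := by
    push_cast; ring
  rw [e]
  refine (norm_add_le _ _).trans ?_
  have h5 := norm_add_le (logDeriv (gammaQuot ψ) s) (logDeriv (gammaQuot (ψ.mul χ)) s)
  rw [norm_real, Real.norm_eq_abs]
  have h6 : |2 * logD D ^ 2 - Real.log q - Real.log (Nat.lcm q D : ℕ)| ≤ 3 * logD D :=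
    abs_le.2 ⟨by linarith, by linarith⟩
  linarith

end Twist

/-! ### The Dirichlet polynomial `F` -/

theorem conj_nu {D : ℕ} {χ : DirichletCharacter ℂ D} (hχ : ∀ a, (χ a).im = 0) (n : ℕ) :
    starRingEnd ℂ (nu χ n) = nu χ n := by
  rw [nu, map_sum]
  exact Finset.sum_congr rfl fun p _ => conj_eq_iff_im.2 (hχ _)

theorem F_inv_one_sub {D q : ℕ} [NeZero q] {χ : DirichletCharacter ℂ D}
    (hχ : ∀ a, (χ a).im = 0) (ψ : DirichletCharacter ℂ q) (s : ℂ) :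
    F χ ψ⁻¹ (1 - s) = starRingEnd ℂ (F χ ψ (1 - starRingEnd ℂ s)) := by
  rw [F, F, map_sum]
  refine Finset.sum_congr rfl fun n _ => ?_
  rw [map_div₀, map_mul, conj_nu hχ, conj_natCast_cpow, inv_apply_eq_conj]
  simp

theorem norm_nu_le {D : ℕ} (χ : DirichletCharacter ℂ D) (n : ℕ) :
    ‖nu χ n‖ ≤ n.divisorsAntidiagonal.card := by
  refine (norm_sum_le _ _).trans ?_
  rw [Finset.card_eq_sum_ones, Nat.cast_sum]
  exact Finset.sum_le_sum fun p _ => by simpa using χ.norm_le_one _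

/-- The trivial bound for `F`, from `|ν(n)| ≤ d(n)`. The exponent `11 / 10` could be any number
above `1` and below `1 / 2 + 18 / 25`; see `norm_reflectedRatio_le_half`. -/
theorem exists_norm_F_le : ∃ C : ℝ, 0 < C ∧ ∀ (D q : ℕ) (χ : DirichletCharacter ℂ D)
    (ψ : DirichletCharacter ℂ q) (s : ℂ), 1 ≤ D → s.re ≤ 11 / 10 →
      ‖F χ ψ s‖ ≤ C * (D : ℝ) ^ (5 * (11 / 10 - s.re)) := by
  -- Rankin's trick: the divisor series converges at `11 / 10`
  have h1 : LSeriesSummable 1 ((11 / 10 : ℝ) : ℂ) :=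
    LSeriesSummable_one_iff.2 (by rw [ofReal_re]; norm_num)
  have h2 := (h1.convolution h1).norm
  set t := fun n : ℕ => ‖LSeries.term (LSeries.convolution 1 1) ((11 / 10 : ℝ) : ℂ) n‖ with ht
  have ht' : ∀ n : ℕ, n ≠ 0 → t n = n.divisorsAntidiagonal.card / (n : ℝ) ^ (11 / 10 : ℝ) := by
    intro n hn
    simp only [ht]
    rw [LSeries.term_of_ne_zero hn, norm_div, norm_natCast_cpow_of_pos (Nat.pos_of_ne_zero hn),
      ofReal_re, LSeries.convolution_def]
    simp
  refine ⟨∑' n, t n + 1, by positivity, ?_⟩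
  intro D q χ ψ s hD hs
  have hD' : (1 : ℝ) ≤ D := by exact_mod_cast hD
  have hterm : ∀ n ∈ Finset.Icc 1 (D ^ 5), ‖nu χ n * ψ n / (n : ℂ) ^ s‖ ≤
      t n * (D : ℝ) ^ (5 * (11 / 10 - s.re)) := by
    intro n hn
    obtain ⟨hn1, hn2⟩ := Finset.mem_Icc.1 hn
    have hn1' : (1 : ℝ) ≤ n := by exact_mod_cast hn1
    have hn0 : (0 : ℝ) < n := by linarith
    have hn2' : (n : ℝ) ≤ (D : ℝ) ^ (5 : ℝ) := by
      rw [show (5 : ℝ) = ((5 : ℕ) : ℝ) by norm_num, Real.rpow_natCast]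
      exact_mod_cast hn2
    rw [ht' n (by omega), norm_div, norm_mul, norm_natCast_cpow_of_pos (by omega)]
    have h3 : ‖nu χ n‖ * ‖ψ n‖ ≤ n.divisorsAntidiagonal.card := by
      have := norm_nu_le χ n
      have := ψ.norm_le_one n
      nlinarith [norm_nonneg (nu χ n)]
    have h4 : (n : ℝ) ^ (11 / 10 - s.re) ≤ (D : ℝ) ^ (5 * (11 / 10 - s.re)) := by
      rw [Real.rpow_mul (by linarith)]
      exact Real.rpow_le_rpow hn0.le hn2' (by linarith)
    calc ‖nu χ n‖ * ‖ψ n‖ / (n : ℝ) ^ s.re ≤ n.divisorsAntidiagonal.card / (n : ℝ) ^ s.re := by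
          gcongr
      _ = n.divisorsAntidiagonal.card / (n : ℝ) ^ (11 / 10 : ℝ) * (n : ℝ) ^ (11 / 10 - s.re) := by
          rw [Real.rpow_sub hn0]
          have := Real.rpow_pos_of_pos hn0 (11 / 10)
          have := Real.rpow_pos_of_pos hn0 s.re
          field_simp
      _ ≤ _ := by gcongr
  rw [F]
  refine (norm_sum_le _ _).trans ((Finset.sum_le_sum hterm).trans ?_)
  rw [← Finset.sum_mul]
  have h5 : ∑ n ∈ Finset.Icc 1 (D ^ 5), t n ≤ ∑' n, t n :=
    h2.sum_le_tsum _ fun n _ => norm_nonneg _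
  gcongr
  linarith

theorem differentiableAt_F {D q : ℕ} (χ : DirichletCharacter ℂ D) (ψ : DirichletCharacter ℂ q)
    (s : ℂ) : DifferentiableAt ℂ (F χ ψ) s := by
  unfold F
  refine DifferentiableAt.fun_sum fun n hn => ?_
  have hn0 : (n : ℂ) ≠ 0 := by
    have := (Finset.mem_Icc.1 hn).1
    exact_mod_cast (by omega : n ≠ 0)
  refine DifferentiableAt.div (by fun_prop)
    (DifferentiableAt.const_cpow differentiableAt_id (Or.inl hn0)) ?_
  simp [cpow_eq_zero_iff, hn0]

theorem norm_F_inv_one_sub {D q : ℕ} [NeZero q] {χ : DirichletCharacter ℂ D}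
    (hχ : ∀ a, (χ a).im = 0) (ψ : DirichletCharacter ℂ q)
    (s : ℂ) :
    ‖F χ ψ⁻¹ (1 - s)‖ = ‖F χ ψ (1 - starRingEnd ℂ s)‖ := by
  rw [F_inv_one_sub hχ, norm_conj]

theorem differentiableAt_F_inv_one_sub {D q : ℕ} (χ : DirichletCharacter ℂ D)
    (ψ : DirichletCharacter ℂ q) (s : ℂ) : DifferentiableAt ℂ (fun z => F χ ψ⁻¹ (1 - z)) s :=
  DifferentiableAt.comp (g := F χ ψ⁻¹) s (differentiableAt_F χ ψ⁻¹ (1 - s)) (by fun_prop)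

/-! ### Zeros near the critical line -/

/-- The situation near the critical line: the zeros under study are those of `1 + B + e`, where
`B` has modulus `1` on the critical line and logarithmic derivative close to `-2 N`, and where `e`
is small. All bounds hold on the strip `|σ - 1/2| ≤ 1 / (20 N)`, at heights within `H` of `T`. -/
structure NearCritical (B e : ℂ → ℂ) (T H N κ ε : ℝ) : Prop where
  N_pos : 0 < N
  κ_nonneg : 0 ≤ κ
  κ_le : κ ≤ 1 / 20
  ε_pos : 0 < ε
  ε_le : ε ≤ 1 / 200
  differentiableAt_B : ∀ s : ℂ, |s.re - 1 / 2| ≤ 1 / (20 * N) → |s.im - T| < H →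
    DifferentiableAt ℂ B s
  B_ne_zero : ∀ s : ℂ, |s.re - 1 / 2| ≤ 1 / (20 * N) → |s.im - T| < H → B s ≠ 0
  norm_logDeriv_add_le : ∀ s : ℂ, |s.re - 1 / 2| ≤ 1 / (20 * N) → |s.im - T| < H →
    ‖logDeriv B s + 2 * N‖ ≤ 2 * κ * N
  norm_B_eq_one : ∀ s : ℂ, s.re = 1 / 2 → |s.im - T| < H → ‖B s‖ = 1
  differentiableAt_e : ∀ s : ℂ, |s.re - 1 / 2| ≤ 1 / (20 * N) → |s.im - T| < H →
    DifferentiableAt ℂ e s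
  norm_e_le : ∀ s : ℂ, |s.re - 1 / 2| ≤ 1 / (20 * N) → |s.im - T| < H → ‖e s‖ ≤ ε
  norm_deriv_e_le : ∀ s : ℂ, |s.re - 1 / 2| ≤ 1 / (20 * N) → |s.im - T| < H →
    ‖deriv e s‖ ≤ 10 * ε * N

theorem hasDerivAt_vertical {f : ℂ → ℂ} {f' : ℂ} {t : ℝ}
    (hf : HasDerivAt f f' (1 / 2 + t * I)) :
    HasDerivAt (fun x : ℝ => f (1 / 2 + x * I)) (f' * I) t := by
  have h1 : HasDerivAt (fun z : ℂ => 1 / 2 + z * I) I (t : ℂ) := by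
    simpa using ((hasDerivAt_id (t : ℂ)).mul_const I).const_add (1 / 2)
  exact (HasDerivAt.comp (t : ℂ) (h₂ := f) hf h1).comp_ofReal

/-- The hypothesis `hreal` is the functional equation on the critical line; it says that
`exp (-i θ) (1 + B + e)` equals its own conjugate. -/
theorem exp_neg_mul_eq_ofReal {B e : ℂ} {θ : ℝ} (hB : B = exp (2 * θ * I))
    (hreal : starRingEnd ℂ (1 + B + e) * B = 1 + B + e) :
    exp (-(θ * I)) * (1 + B + e) =
      ((2 * Real.cos θ + (exp (-(θ * I)) * e).re : ℝ) : ℂ) := by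
  have hconj : starRingEnd ℂ (exp (-(θ * I))) = exp (θ * I) := by
    rw [← exp_conj]; simp
  have h1 : B = exp (θ * I) * exp (θ * I) := by rw [hB, ← exp_add]; congr 1; ring
  have h2 : exp (-(θ * I)) * exp (θ * I) = 1 := by rw [← exp_add, neg_add_cancel, exp_zero]
  have h3 : exp (-(θ * I)) * (1 + B + e) = 2 * (Real.cos θ : ℂ) + exp (-(θ * I)) * e := by
    rw [ofReal_cos, Complex.cos, h1, show -(θ : ℂ) * I = -(θ * I) by ring]
    linear_combination exp (θ * I) * h2
  have h4 : starRingEnd ℂ (exp (-(θ * I)) * (1 + B + e)) = exp (-(θ * I)) * (1 + B + e) := by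
    have h5 : ∀ c : ℂ, exp (θ * I) * c = exp (-(θ * I)) * (c * B) := fun c => by
      rw [h1]; linear_combination -(exp (θ * I) * c) * h2
    rw [map_mul, hconj, h5, hreal]
  rw [← conj_eq_iff_re.1 h4]
  congr 1
  rw [h3, add_re, ← ofReal_ofNat, ← ofReal_mul, ofReal_re]

namespace NearCritical

variable {B e : ℂ → ℂ} {T H N κ ε : ℝ}

theorem two_mul_div_le (h : NearCritical B e T H N κ ε) : 2 * ε / N ≤ 1 / (20 * N) := by
  have := h.N_pos
  rw [div_le_div_iff₀ this (by positivity)]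
  nlinarith [h.ε_le]

theorem norm_B_le_two (h : NearCritical B e T H N κ ε) {s : ℂ}
    (hs : |s.re - 1 / 2| ≤ 1 / (20 * N)) (hi : |s.im - T| < H) : ‖B s‖ ≤ 2 := by
  have hN := h.N_pos
  obtain ⟨h1, h2⟩ := abs_le.1 hs
  have hmem : ∀ x : ℝ, |x - 1 / 2| ≤ 1 / (20 * N) →
      |((x : ℂ) + s.im * I).re - 1 / 2| ≤ 1 / (20 * N) ∧ |((x : ℂ) + s.im * I).im - T| < H :=
    fun x hx => ⟨by simpa using hx, by simpa using hi⟩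
  have hlog : ∀ x : ℝ, |x - 1 / 2| ≤ 1 / (20 * N) →
      |(logDeriv B (x + s.im * I)).re + 2 * N| ≤ 2 * κ * N := fun x hx => by
    have := (abs_re_le_norm _).trans (h.norm_logDeriv_add_le _ (hmem x hx).1 (hmem x hx).2)
    simpa using this
  have hcrit : ‖B ((1 / 2 : ℝ) + s.im * I)‖ = 1 :=
    h.norm_B_eq_one _ (by simp) (by simpa using hi)
  have hκ := h.κ_le
  have hκN : 2 * κ * N ≤ N / 10 := by nlinarith
  rcases le_total (1 / 2) s.re with hle | hle
  · have := norm_le_exp_mul_of_re_logDeriv_le (f := B) (t := s.im) (M := 0) hle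
      (fun x hx => h.differentiableAt_B _
        (hmem x (abs_le.2 ⟨by linarith [hx.1], by linarith [hx.2]⟩)).1 (by simpa using hi))
      (fun x hx => h.B_ne_zero _ (hmem x (abs_le.2 ⟨by linarith [hx.1], by linarith [hx.2]⟩)).1
        (by simpa using hi))
      (fun x hx => by
        have := abs_le.1 (hlog x (abs_le.2 ⟨by linarith [hx.1], by linarith [hx.2]⟩))
        linarith [this.2])
    rw [hcrit, re_add_im] at this
    simp only [neg_zero, zero_mul, Real.exp_zero, mul_one] at this
    linarith
  · have := norm_le_exp_mul_of_le_re_logDeriv (f := B) (t := s.im) (M := 3 * N) hle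
      (fun x hx => h.differentiableAt_B _
        (hmem x (abs_le.2 ⟨by linarith [hx.1], by linarith [hx.2]⟩)).1 (by simpa using hi))
      (fun x hx => h.B_ne_zero _ (hmem x (abs_le.2 ⟨by linarith [hx.1], by linarith [hx.2]⟩)).1
        (by simpa using hi))
      (fun x hx => by
        have := abs_le.1 (hlog x (abs_le.2 ⟨by linarith [hx.1], by linarith [hx.2]⟩))
        linarith [this.1])
    rw [hcrit, re_add_im, mul_one] at this
    refine this.trans ?_
    have h3 : 3 * N * (1 / 2 - s.re) ≤ 3 / 20 := by
      have : 3 * N * (1 / 2 - s.re) ≤ 3 * N * (1 / (20 * N)) := by gcongr; linarith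
      refine this.trans (le_of_eq ?_)
      field_simp
    have h4 : Real.exp (3 / 20) ≤ 2 := by
      rw [← Real.le_log_iff_exp_le (by norm_num)]
      linarith [Real.log_two_gt_d9]
    exact (Real.exp_le_exp.2 h3).trans h4

theorem norm_deriv_B_le (h : NearCritical B e T H N κ ε) {s : ℂ}
    (hs : |s.re - 1 / 2| ≤ 1 / (20 * N)) (hi : |s.im - T| < H) : ‖deriv B s‖ ≤ 5 * N := by
  have hN := h.N_pos
  have h1 : deriv B s = B s * logDeriv B s := by
    rw [logDeriv_apply, mul_div_cancel₀ _ (h.B_ne_zero s hs hi)]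
  have h2 : ‖logDeriv B s‖ ≤ 5 / 2 * N := by
    have h3 := norm_sub_le (logDeriv B s + 2 * N) (2 * N)
    rw [add_sub_cancel_right] at h3
    have h4 : ‖(2 * N : ℂ)‖ = 2 * N := by
      rw [show (2 * N : ℂ) = ((2 * N : ℝ) : ℂ) by push_cast; ring, norm_real,
        Real.norm_of_nonneg (by positivity)]
    have := h.norm_logDeriv_add_le s hs hi
    nlinarith [h.κ_le]
  rw [h1, norm_mul]
  have := h.norm_B_le_two hs hi
  nlinarith [norm_nonneg (B s), norm_nonneg (logDeriv B s)]

/-- Next to a zero `s` of `1 + B + e` the function `B` is close to `-1`, so that the derivative of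
`1 + B + e` is close to `2 N`; this holds on the whole horizontal chord of the strip through `s`. -/
theorem re_deriv_pos (h : NearCritical B e T H N κ ε) {s u : ℂ}
    (hs : |s.re - 1 / 2| ≤ 2 * ε / N) (hi : |s.im - T| < H) (h0 : 1 + B s + e s = 0)
    (hu : |u.re - 1 / 2| ≤ 2 * ε / N) (him : u.im = s.im) :
    0 < (deriv B u + deriv e u).re := by
  have hN := h.N_pos
  have hε := h.ε_pos
  have hs' := hs.trans h.two_mul_div_le
  have hu' := hu.trans h.two_mul_div_le
  have hi' : |u.im - T| < H := by rw [him]; exact hi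
  have hconv : Convex ℝ {z : ℂ | z.re ∈ Set.Icc (1 / 2 - 2 * ε / N) (1 / 2 + 2 * ε / N) ∧
      z.im ∈ ({s.im} : Set ℝ)} :=
    ((convex_Icc _ _).linear_preimage reLm).inter ((convex_singleton _).linear_preimage imLm)
  have hmv := hconv.norm_image_sub_le_of_norm_deriv_le (f := B) (C := 5 * N) (x := s) (y := u)
    (fun z hz => h.differentiableAt_B z ((abs_le.2
      ⟨by linarith [hz.1.1], by linarith [hz.1.2]⟩ : |z.re - 1 / 2| ≤ 2 * ε / N).trans
        h.two_mul_div_le) (by rw [hz.2]; exact hi))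
    (fun z hz => h.norm_deriv_B_le ((abs_le.2
      ⟨by linarith [hz.1.1], by linarith [hz.1.2]⟩ : |z.re - 1 / 2| ≤ 2 * ε / N).trans
        h.two_mul_div_le) (by rw [hz.2]; exact hi))
    ⟨⟨by linarith [(abs_le.1 hs).1], by linarith [(abs_le.1 hs).2]⟩, rfl⟩
    ⟨⟨by linarith [(abs_le.1 hu).1], by linarith [(abs_le.1 hu).2]⟩, him⟩
  have hdist : ‖u - s‖ ≤ 4 * ε / N := by
    have h1 : u - s = ((u.re - s.re : ℝ) : ℂ) := by
      apply Complex.ext <;> simp [him]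
    rw [h1, norm_real, Real.norm_eq_abs]
    have := abs_sub_le u.re (1 / 2) s.re
    rw [abs_sub_comm (1 / 2) s.re] at this
    have e1 : 4 * ε / N = 2 * ε / N + 2 * ε / N := by ring
    linarith
  have hBu : ‖B u + 1‖ ≤ 21 * ε := by
    have h1 : B u + 1 = (B u - B s) - e s := by linear_combination h0
    have h2 := norm_sub_le (B u - B s) (e s)
    rw [← h1] at h2
    have h3 := h.norm_e_le s hs' hi
    have h4 : 5 * N * ‖u - s‖ ≤ 20 * ε := by
      calc 5 * N * ‖u - s‖ ≤ 5 * N * (4 * ε / N) := by gcongr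
        _ = 20 * ε := by field_simp; ring
    linarith
  have hb := h.norm_logDeriv_add_le u hu' hi'
  have hde := h.norm_deriv_e_le u hu' hi'
  set b := logDeriv B u with hbdef
  have h1 : deriv B u = B u * b := by
    rw [hbdef, logDeriv_apply, mul_div_cancel₀ _ (h.B_ne_zero u hu' hi')]
  have h2 : deriv B u + deriv e u = ((2 * N : ℝ) : ℂ) -
      ((b + 2 * N) + (B u + 1) * ((2 * N : ℝ) : ℂ) - (B u + 1) * (b + 2 * N) - deriv e u) := by
    rw [h1]; push_cast; ring
  have h3 : ‖(b + 2 * N) + (B u + 1) * ((2 * N : ℝ) : ℂ) - (B u + 1) * (b + 2 * N) - deriv e u‖ ≤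
      N := by
    refine (norm_sub_le _ _).trans ?_
    have h4 := norm_sub_le ((b + 2 * N) + (B u + 1) * ((2 * N : ℝ) : ℂ)) ((B u + 1) * (b + 2 * N))
    have h5 := norm_add_le (b + 2 * N) ((B u + 1) * ((2 * N : ℝ) : ℂ))
    rw [norm_mul, norm_real, Real.norm_of_nonneg (by positivity)] at h5
    rw [norm_mul] at h4
    have hεle := h.ε_le
    have hκ := h.κ_le
    have h6 : ‖b + 2 * N‖ ≤ N / 10 := by nlinarith
    have h7 : ‖B u + 1‖ ≤ 21 / 200 := by linarith
    have h8 : ‖B u + 1‖ * (2 * N) ≤ 21 / 200 * (2 * N) := by gcongr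
    have h9 : ‖B u + 1‖ * ‖b + 2 * N‖ ≤ 21 / 200 * (N / 10) := by gcongr
    have h10 : 10 * ε * N ≤ N / 20 := by nlinarith
    linarith
  rw [h2, sub_re, ofReal_re]
  have := (re_le_norm _).trans h3
  linarith

theorem deriv_ne_zero (h : NearCritical B e T H N κ ε) {s : ℂ}
    (hs : |s.re - 1 / 2| ≤ 2 * ε / N) (hi : |s.im - T| < H) (h0 : 1 + B s + e s = 0) :
    deriv B s + deriv e s ≠ 0 := by
  intro hz
  have := h.re_deriv_pos hs hi h0 hs rfl
  rw [hz] at this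
  simp at this

/-- If zeros come in pairs `s`, `1 - s̄`, then those near the critical line lie on it: the real part
of `1 + B + e` would otherwise vanish at both ends of a chord on which it is strictly monotone. -/
theorem re_eq_half (h : NearCritical B e T H N κ ε) {s : ℂ}
    (hs : |s.re - 1 / 2| ≤ 2 * ε / N) (hi : |s.im - T| < H) (h0 : 1 + B s + e s = 0)
    (h0' : 1 + B (1 - starRingEnd ℂ s) + e (1 - starRingEnd ℂ s) = 0) : s.re = 1 / 2 := by
  have key : ∀ a b : ℝ, a < b → |a - 1 / 2| ≤ 2 * ε / N → |b - 1 / 2| ≤ 2 * ε / N →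
      1 + B (a + s.im * I) + e (a + s.im * I) = 0 → 1 + B (b + s.im * I) + e (b + s.im * I) = 0 →
      False := by
    intro a b hab ha hb ha0 hb0
    have hd : ∀ x ∈ Set.Icc a b, HasDerivAt (fun y : ℝ => (1 + B (y + s.im * I) +
        e (y + s.im * I)).re) (deriv B (x + s.im * I) + deriv e (x + s.im * I)).re x ∧
        0 < (deriv B (x + s.im * I) + deriv e (x + s.im * I)).re := by
      intro x hx
      have hx' : |((x : ℂ) + s.im * I).re - 1 / 2| ≤ 2 * ε / N := by
        simp only [add_re, ofReal_re, mul_re, I_re, mul_zero, ofReal_im, I_im, mul_one, sub_self,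
          add_zero]
        exact abs_le.2 ⟨by linarith [hx.1, (abs_le.1 ha).1], by linarith [hx.2, (abs_le.1 hb).2]⟩
      have hx'' := hx'.trans h.two_mul_div_le
      have hxi : |((x : ℂ) + s.im * I).im - T| < H := by simpa using hi
      refine ⟨?_, h.re_deriv_pos hs hi h0 hx' (by simp)⟩
      have h1 := (h.differentiableAt_B _ hx'' hxi).hasDerivAt.comp_add_const (x : ℂ) (s.im * I)
      have h2 := (h.differentiableAt_e _ hx'' hxi).hasDerivAt.comp_add_const (x : ℂ) (s.im * I)
      exact ((h1.const_add 1).add h2).real_of_complex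
    obtain ⟨x, hx, hx0⟩ := exists_hasDerivAt_eq_zero hab
      (fun x hx => (hd x hx).1.continuousAt.continuousWithinAt) (by rw [ha0, hb0])
      (fun x hx => (hd x (Set.Ioo_subset_Icc_self hx)).1)
    exact (hd x (Set.Ioo_subset_Icc_self hx)).2.ne' hx0
  have e1 : ((s.re : ℝ) : ℂ) + s.im * I = s := re_add_im s
  have e2 : ((1 - s.re : ℝ) : ℂ) + s.im * I = 1 - starRingEnd ℂ s := by
    apply Complex.ext <;> simp
  have hs2 : |1 - s.re - 1 / 2| ≤ 2 * ε / N := by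
    rw [show 1 - s.re - 1 / 2 = -(s.re - 1 / 2) by ring, abs_neg]; exact hs
  rcases lt_trichotomy s.re (1 / 2) with hlt | heq | hlt
  · exact (key s.re (1 - s.re) (by linarith) hs hs2 (by rw [e1]; exact h0)
      (by rw [e2]; exact h0')).elim
  · exact heq
  · exact (key (1 - s.re) s.re (by linarith) hs2 hs (by rw [e2]; exact h0')
      (by rw [e1]; exact h0)).elim

/-- A continuous argument of `B` on the critical line, written as twice an angle `θ`. -/
theorem exists_phase (h : NearCritical B e T H N κ ε) {γ : ℝ} (hγ : |γ - T| < H) :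
    ∃ θ : ℝ → ℝ, ∀ t : ℝ, |t - T| < H → B (1 / 2 + t * I) = exp (2 * θ t * I) ∧
      HasDerivAt θ ((logDeriv B (1 / 2 + t * I)).re / 2) t := by
  have hN := h.N_pos
  have hmem : ∀ t : ℝ, |t - T| < H → |((1 / 2 + t * I : ℂ)).re - 1 / 2| ≤ 1 / (20 * N) ∧
      |((1 / 2 + t * I : ℂ)).im - T| < H := by
    intro t ht
    refine ⟨?_, by simpa using ht⟩
    have : (0 : ℝ) ≤ 1 / (20 * N) := by positivity
    simpa using this
  set φ : ℝ → ℂ := fun t => logDeriv B (1 / 2 + t * I) * I with hφ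
  set S : Set ℝ := Set.Ioo (T - H) (T + H) with hS
  have hSmem : ∀ t, t ∈ S ↔ |t - T| < H := fun t => by
    rw [abs_lt]
    exact ⟨fun ht => ⟨by linarith [ht.1], by linarith [ht.2]⟩,
      fun ht => ⟨by linarith [ht.1], by linarith [ht.2]⟩⟩
  have hφc : ContinuousOn φ S := by
    intro t ht
    have hm := (hSmem t).1 ht
    apply ContinuousAt.continuousWithinAt
    have hU : IsOpen {z : ℂ | z.re ∈ Set.Ioo (1 / 2 - 1 / (20 * N)) (1 / 2 + 1 / (20 * N)) ∧
        z.im ∈ S} :=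
      (isOpen_Ioo.preimage continuous_re).inter (isOpen_Ioo.preimage continuous_im)
    have hd : DifferentiableOn ℂ B {z : ℂ | z.re ∈ Set.Ioo (1 / 2 - 1 / (20 * N))
        (1 / 2 + 1 / (20 * N)) ∧ z.im ∈ S} := fun z hz =>
      (h.differentiableAt_B z (abs_le.2 ⟨by linarith [hz.1.1], by linarith [hz.1.2]⟩)
        ((hSmem _).1 hz.2)).differentiableWithinAt
    have hz : (1 / 2 + t * I : ℂ) ∈ {z : ℂ | z.re ∈ Set.Ioo (1 / 2 - 1 / (20 * N))
        (1 / 2 + 1 / (20 * N)) ∧ z.im ∈ S} := by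
      have : (0 : ℝ) < 1 / (20 * N) := by positivity
      refine ⟨⟨?_, ?_⟩, ?_⟩
      · simpa using this
      · simpa using this
      · simpa using ht
    have h1 : ContinuousAt (logDeriv B) (1 / 2 + t * I) := by
      have h2 := ((hd.deriv hU).differentiableAt (hU.mem_nhds hz)).continuousAt
      have h3 := (hd.differentiableAt (hU.mem_nhds hz)).continuousAt
      exact h2.div h3 (h.B_ne_zero _ (hmem t hm).1 (hmem t hm).2)
    have h4 : ContinuousAt (fun t : ℝ => (1 / 2 + t * I : ℂ)) t := by fun_prop
    exact (ContinuousAt.comp (f := fun t : ℝ => (1 / 2 + t * I : ℂ)) (x := t) h1 h4).mul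
      continuousAt_const
  obtain ⟨c, hc⟩ : ∃ c, exp c = B (1 / 2 + γ * I) :=
    ⟨log _, exp_log (h.B_ne_zero _ (hmem γ hγ).1 (hmem γ hγ).2)⟩
  set g : ℝ → ℂ := fun t => c + ∫ x in γ..t, φ x with hg
  have hγS : γ ∈ S := (hSmem γ).2 hγ
  have hgd : ∀ t ∈ S, HasDerivAt g (φ t) t := by
    intro t ht
    have hsub : Set.uIcc γ t ⊆ S := Set.ordConnected_Ioo.uIcc_subset hγS ht
    have := intervalIntegral.integral_hasDerivAt_right (f := φ) (a := γ) (b := t)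
      ((hφc.mono hsub).intervalIntegrable)
      (hφc.stronglyMeasurableAtFilter isOpen_Ioo t ht)
      (hφc.continuousAt (isOpen_Ioo.mem_nhds ht))
    exact this.const_add c
  have hBd : ∀ t ∈ S, HasDerivAt (fun x : ℝ => B (1 / 2 + x * I))
      (deriv B (1 / 2 + t * I) * I) t := fun t ht =>
    hasDerivAt_vertical (h.differentiableAt_B _ (hmem t ((hSmem t).1 ht)).1
      (hmem t ((hSmem t).1 ht)).2).hasDerivAt
  have hexp : ∀ t ∈ S, B (1 / 2 + t * I) = exp (g t) := by
    have hd : ∀ t ∈ S, HasDerivAt (fun x : ℝ => B (1 / 2 + x * I) * exp (-g x)) 0 t := by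
      intro t ht
      have h1 := (hBd t ht).mul ((hgd t ht).neg.cexp)
      refine (show HasDerivAt (fun x : ℝ => B (1 / 2 + x * I) * exp (-g x)) _ t from
        h1).congr_deriv ?_
      have h0 := h.B_ne_zero _ (hmem t ((hSmem t).1 ht)).1 (hmem t ((hSmem t).1 ht)).2
      have h2 := mul_div_cancel₀ (deriv B (1 / 2 + t * I)) h0
      simp only [hφ, logDeriv_apply, Pi.neg_apply]
      linear_combination -(exp (-g t) * I) * h2
    intro t ht
    have h4 := (convex_Ioo (T - H) (T + H)).is_const_of_fderivWithin_eq_zero (𝕜 := ℝ)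
      (f := fun x : ℝ => B (1 / 2 + x * I) * exp (-g x))
      (fun x hx => (hd x hx).differentiableAt.differentiableWithinAt)
      (fun x hx => by
        rw [fderivWithin_of_isOpen isOpen_Ioo hx]
        ext
        simpa using (hd x hx).deriv) ht hγS
    have hgγ : g γ = c := by simp [hg]
    simp only [hgγ, ← hc] at h4
    rw [← exp_add, add_neg_cancel, exp_zero] at h4
    calc B (1 / 2 + t * I) = B (1 / 2 + t * I) * exp (-g t) * exp (g t) := by
          rw [mul_assoc, ← exp_add, neg_add_cancel, exp_zero, mul_one]
      _ = exp (g t) := by rw [h4, one_mul]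
  refine ⟨fun t => (g t).im / 2, fun t ht => ⟨?_, ?_⟩⟩
  · have h1 := hexp t ((hSmem t).2 ht)
    have h2 := h.norm_B_eq_one (1 / 2 + t * I) (by simp) (by simpa using ht)
    rw [h1, norm_exp, Real.exp_eq_one_iff] at h2
    rw [h1]
    congr 1
    apply Complex.ext
    · simp [h2]
    · simp; ring
  · have h1 := (imCLM.hasFDerivAt.comp_hasDerivAt t (hgd t ((hSmem t).2 ht))).div_const 2
    simpa [hφ] using! h1

/-- Dividing `1 + B + e` by `exp (i θ)`, where `B = exp (2 i θ)`, turns its zeros on the critical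
line into those of the real function `2 cos θ + r`. -/
theorem abs_zero_gap_sub_le (h : NearCritical B e T H N κ ε)
    (hreal : ∀ t : ℝ, |t - T| < H →
      starRingEnd ℂ (1 + B (1 / 2 + t * I) + e (1 / 2 + t * I)) * B (1 / 2 + t * I) =
        1 + B (1 / 2 + t * I) + e (1 / 2 + t * I)) {γ₁ γ₂ : ℝ} (hγ : γ₁ < γ₂)
    (hγ₁ : |γ₁ - T| < H) (hγ₂ : |γ₂ - T| < H)
    (h₁ : 1 + B (1 / 2 + γ₁ * I) + e (1 / 2 + γ₁ * I) = 0)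
    (h₂ : 1 + B (1 / 2 + γ₂ * I) + e (1 / 2 + γ₂ * I) = 0)
    (hne : ∀ t ∈ Set.Ioo γ₁ γ₂, 1 + B (1 / 2 + t * I) + e (1 / 2 + t * I) ≠ 0) :
    |γ₂ - γ₁ - Real.pi / N| ≤ 7 * (κ + ε) / N := by
  have hN := h.N_pos
  have hε := h.ε_pos
  have hεle := h.ε_le
  have hκle := h.κ_le
  have hmem : ∀ t : ℝ, |t - T| < H → |((1 / 2 + t * I : ℂ)).re - 1 / 2| ≤ 1 / (20 * N) ∧
      |((1 / 2 + t * I : ℂ)).im - T| < H := by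
    intro t ht
    refine ⟨?_, by simpa using ht⟩
    have : (0 : ℝ) ≤ 1 / (20 * N) := by positivity
    simpa using this
  have hIcc : ∀ t ∈ Set.Icc γ₁ γ₂, |t - T| < H := fun t ht =>
    abs_lt.2 ⟨by linarith [ht.1, (abs_lt.1 hγ₁).1], by linarith [ht.2, (abs_lt.1 hγ₂).2]⟩
  obtain ⟨θ, hθ⟩ := h.exists_phase hγ₁
  set E : ℝ → ℂ := fun t => exp (-(θ t * I)) with hE
  have hEnorm : ∀ t, ‖E t‖ = 1 := fun t => by
    simp only [hE]; rw [← neg_mul, ← ofReal_neg, norm_exp_ofReal_mul_I]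
  set θ' : ℝ → ℝ := fun t => (logDeriv B (1 / 2 + t * I)).re / 2 with hθ'
  set r : ℝ → ℝ := fun t => (E t * e (1 / 2 + t * I)).re with hr
  set r' : ℝ → ℝ := fun t => (E t * -(θ' t * I) * e (1 / 2 + t * I) +
    E t * (deriv e (1 / 2 + t * I) * I)).re with hr'
  have hθbd : ∀ t ∈ Set.Icc γ₁ γ₂, |θ' t + N| ≤ κ * N := by
    intro t ht
    have h1 := (abs_re_le_norm _).trans
      (h.norm_logDeriv_add_le _ (hmem t (hIcc t ht)).1 (hmem t (hIcc t ht)).2)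
    have h2 : (logDeriv B (1 / 2 + t * I) + 2 * N).re = 2 * (θ' t + N) := by
      simp [hθ']; ring
    rw [h2, abs_mul, abs_two] at h1
    linarith
  have hzero : ∀ t ∈ Set.Icc γ₁ γ₂, (1 + B (1 / 2 + t * I) + e (1 / 2 + t * I) = 0 ↔
      2 * Real.cos (θ t) + r t = 0) := by
    intro t ht
    have h1 := exp_neg_mul_eq_ofReal (hθ t (hIcc t ht)).1 (hreal t (hIcc t ht))
    rw [← ofReal_eq_zero (z := 2 * Real.cos (θ t) + r t)]
    have h2 : ((2 * Real.cos (θ t) + r t : ℝ) : ℂ) =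
        exp (-(θ t * I)) * (1 + B (1 / 2 + t * I) + e (1 / 2 + t * I)) := h1.symm
    rw [h2, mul_eq_zero]
    simp [exp_ne_zero]
  refine DirichletZeros.abs_zero_gap_sub_le_of_cos (θ := θ) (θ' := θ') (r := r) (r' := r') hγ hN
    h.κ_nonneg (by linarith) hε (by linarith)
    (fun t ht => (hθ t (hIcc t ht)).2) hθbd ?_ ?_ ?_
    ((hzero γ₁ (Set.left_mem_Icc.2 hγ.le)).1 h₁) ((hzero γ₂ (Set.right_mem_Icc.2 hγ.le)).1 h₂)
    (fun t ht h0 => hne t ht ((hzero t (Set.Ioo_subset_Icc_self ht)).2 h0))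
  · intro t ht
    have h1 : HasDerivAt E (E t * -(θ' t * I)) t :=
      (((hθ t (hIcc t ht)).2.ofReal_comp.mul_const I).neg).cexp
    have h2 := hasDerivAt_vertical
      (h.differentiableAt_e _ (hmem t (hIcc t ht)).1 (hmem t (hIcc t ht)).2).hasDerivAt
    exact reCLM.hasFDerivAt.comp_hasDerivAt t (h1.mul h2)
  · intro t ht
    refine (abs_re_le_norm _).trans ?_
    rw [norm_mul, hEnorm, one_mul]
    exact h.norm_e_le _ (hmem t (hIcc t ht)).1 (hmem t (hIcc t ht)).2
  · intro t ht
    refine (abs_re_le_norm _).trans ((norm_add_le _ _).trans ?_)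
    rw [norm_mul, norm_mul, norm_mul, norm_mul, hEnorm, norm_neg, norm_mul, norm_I, norm_real,
      Real.norm_eq_abs, mul_one, mul_one, one_mul, one_mul]
    have h1 := h.norm_e_le _ (hmem t (hIcc t ht)).1 (hmem t (hIcc t ht)).2
    have h2 := h.norm_deriv_e_le _ (hmem t (hIcc t ht)).1 (hmem t (hIcc t ht)).2
    have h3 : |θ' t| ≤ 2 * N := by
      obtain ⟨h4, h5⟩ := abs_le.1 (hθbd t ht)
      exact abs_le.2 ⟨by nlinarith, by nlinarith⟩
    have h4 : |θ' t| * ‖e (1 / 2 + t * I)‖ ≤ 2 * N * ε := by gcongr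
    linarith

end NearCritical

/-! ### Estimates on the domains `Ω₁` and `Ω₂` -/

/-- The requirements on the size of `D`, in terms of `ℒ = log D` and of the constant `C` in the trivial
bound for `F`. -/
structure IsLarge (D : ℕ) (C : ℝ) : Prop where
  two_le_log : 2 ≤ Real.log (logD D)
  mul_log_le : 300000 * Real.log (logD D) ≤ logD D
  log_const_le : 2 * (Real.log C + 1) ≤ logD D

theorem exists_isLarge (C : ℝ) : ∃ D₀ : ℕ, ∀ D : ℕ, D₀ ≤ D → IsLarge D C := by
  have hlog : Filter.Tendsto logD Filter.atTop Filter.atTop :=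
    Real.tendsto_log_atTop.comp tendsto_natCast_atTop_atTop
  have h1 : ∀ᶠ D in Filter.atTop, 2 ≤ Real.log (logD D) :=
    (Real.tendsto_log_atTop.comp hlog).eventually_ge_atTop 2
  have h2 : ∀ᶠ D in Filter.atTop, 300000 * Real.log (logD D) ≤ logD D := by
    have h3 := Real.isLittleO_log_id_atTop.bound (c := 1 / 300000) (by norm_num)
    have h4 := hlog.eventually (h3.and (Filter.eventually_ge_atTop 0))
    filter_upwards [h4] with D hD
    obtain ⟨h5, h6⟩ := hD
    rw [id, Real.norm_of_nonneg h6] at h5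
    have := (le_abs_self _).trans h5
    linarith
  obtain ⟨D₀, h⟩ := Filter.eventually_atTop.1
    (h1.and (h2.and (hlog.eventually_ge_atTop (2 * (Real.log C + 1)))))
  exact ⟨D₀, fun D hD => ⟨(h D hD).1, (h D hD).2.1, (h D hD).2.2⟩⟩

namespace IsLarge

variable {D : ℕ} {C : ℝ}

theorem logD_ge (h : IsLarge D C) : 600000 ≤ logD D := by
  linarith [h.two_le_log, h.mul_log_le]

theorem exp_log (h : IsLarge D C) : Real.exp (Real.log (logD D)) = logD D :=
  Real.exp_log (by linarith [h.logD_ge])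

theorem D_pos (h : IsLarge D C) : (0 : ℝ) < D := by
  have h1 : D ≠ 0 := by
    rintro rfl
    have := h.logD_ge
    rw [logD] at this
    norm_num at this
  exact_mod_cast Nat.pos_of_ne_zero h1

theorem exp_logD (h : IsLarge D C) : Real.exp (logD D) = D := Real.exp_log h.D_pos

theorem ten_mul_logD_le (h : IsLarge D C) : 10 * logD D + 4 ≤ D := by
  have h1 := Real.quadratic_le_exp_of_nonneg (x := logD D) (by linarith [h.logD_ge])
  rw [h.exp_logD] at h1
  nlinarith [h.logD_ge]

theorem im_bounds (h : IsLarge D C) {s : ℂ} (hs : |s.im - D| < 1 + 10 * logD D) :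
    3 ≤ s.im ∧ s.im ≤ 2 * D := by
  obtain ⟨h1, h2⟩ := abs_lt.1 hs
  constructor <;> linarith [h.ten_mul_logD_le]

end IsLarge

theorem alpha_eq (D : ℕ) : alpha D = 1 / logD D ^ 2 := by
  rw [alpha, bigQ, Real.log_exp, one_div]

theorem sub_s₀_re (D : ℕ) (s : ℂ) : (s - s₀ D).re = s.re - 1 / 2 := by
  simp [s₀]

theorem sub_s₀_im (D : ℕ) (s : ℂ) : (s - s₀ D).im = s.im - D := by
  simp [s₀]

theorem mem_Omega₁ {D : ℕ} (hL : 0 < logD D) {s : ℂ} (h1 : -(2 / logD D) < s.re - 1 / 2)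
    (h2 : s.re - 1 / 2 < 1) (h3 : |s.im - D| < 1 + 20 * logD D) : s ∈ Omega₁ D := by
  refine ⟨?_, ?_, ?_⟩
  · rw [sub_s₀_re, alpha_eq, Real.sqrt_div zero_le_one, Real.sqrt_one, Real.sqrt_sq hL.le]
    refine lt_of_eq_of_lt ?_ h1
    ring
  · rwa [sub_s₀_re]
  · rwa [sub_s₀_im]

theorem mem_Omega₂ {D : ℕ} {s : ℂ} (h1 : -(Real.log (logD D) / (10 * logD D ^ 2)) < s.re - 1 / 2)
    (h2 : s.re - 1 / 2 < 1 / 2) (h3 : |s.im - D| < 1 + 10 * logD D) : s ∈ Omega₂ D := by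
  refine ⟨?_, ?_, ?_⟩
  · rw [sub_s₀_re, alpha_eq]
    refine lt_of_eq_of_lt ?_ h1
    field_simp
  · rwa [sub_s₀_re]
  · rwa [sub_s₀_im]

theorem two_mul_bound_le {D : ℕ} {C : ℝ} (hD : IsLarge D C) :
    2 * (logD D ^ 3 * Real.log (logD D)) ≤ logD D ^ 5 := by
  have h1 := hD.logD_ge
  have h2 := hD.mul_log_le
  have : 2 * Real.log (logD D) ≤ logD D ^ 2 := by nlinarith
  calc 2 * (logD D ^ 3 * Real.log (logD D)) = logD D ^ 3 * (2 * Real.log (logD D)) := by ring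
    _ ≤ logD D ^ 3 * logD D ^ 2 := by gcongr
    _ = _ := by ring

/-- The points within `9 / (5 ℒ)` of the critical line have their discs of radius `1 / (10 ℒ)`
in `Ω₁`, which extends `2 / ℒ` to the left of that line. -/
theorem mem_Omega₁_of_mem_ball {D : ℕ} {C : ℝ} (hD : IsLarge D C) {s z : ℂ}
    (hs : |s.re - 1 / 2| ≤ 9 / (5 * logD D)) (hi : |s.im - D| < 10 * logD D)
    (hz : z ∈ Metric.ball s (1 / (10 * logD D))) : z ∈ Omega₁ D := by
  have hL := hD.logD_ge
  have hL0 : 0 < logD D := by linarith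
  rw [Metric.mem_ball, dist_eq_norm] at hz
  have hr := (abs_re_le_norm (z - s)).trans hz.le
  have hi' := (abs_im_le_norm (z - s)).trans hz.le
  have hr2 := (abs_re_le_norm (z - s)).trans_lt hz
  rw [sub_re] at hr2
  rw [sub_im] at hi'
  have e1 : 9 / (5 * logD D) + 1 / (10 * logD D) < 2 / logD D := by
    have : 9 / (5 * logD D) + 1 / (10 * logD D) = (19 / 10) / logD D := by field_simp; norm_num
    rw [this]
    gcongr
    norm_num
  have e2 : 2 / logD D < 1 := by rw [div_lt_one hL0]; linarith
  have e3 : 1 / (10 * logD D) < 1 := by rw [div_lt_one (by positivity)]; linarith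
  refine mem_Omega₁ hL0 ?_ ?_ ?_
  · linarith [(abs_le.1 hs).1, (abs_lt.1 hr2).1]
  · linarith [(abs_le.1 hs).2, (abs_lt.1 hr2).2]
  · refine abs_lt.2 ⟨?_, ?_⟩
    · linarith [(abs_lt.1 hi).1, (abs_le.1 hi').1]
    · linarith [(abs_lt.1 hi).2, (abs_le.1 hi').2]

theorem norm_logDeriv_le_of_ball {D : ℕ} {C : ℝ} (hD : IsLarge D C) {f : ℂ → ℂ} {s : ℂ}
    (hf : ∀ z ∈ Metric.ball s (1 / (10 * logD D)), DifferentiableAt ℂ f z)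
    (h0 : ∀ z ∈ Metric.ball s (1 / (10 * logD D)), f z ≠ 0)
    (hb : ∀ z ∈ Metric.ball s (1 / (10 * logD D)), |Real.log ‖f z‖| ≤ 5 * Real.log (logD D)) :
    ‖logDeriv f s‖ ≤ 800 * Real.log (logD D) * logD D := by
  have hL0 : 0 < logD D := by linarith [hD.logD_ge]
  have hl := hD.two_le_log
  refine (norm_logDeriv_le_of_log_norm_mem (a := -(5 * Real.log (logD D)))
    (b := 5 * Real.log (logD D)) (R := 1 / (10 * logD D)) (by positivity) (by linarith)
    (fun z hz => (hf z hz).differentiableWithinAt) h0 (fun z hz => (abs_le.1 (hb z hz)).1)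
    (fun z hz => (abs_le.1 (hb z hz)).2)).trans (le_of_eq ?_)
  field_simp
  ring

theorem one_sub_conj_mem_Omega₁ {D : ℕ} {C : ℝ} (hD : IsLarge D C) {s z : ℂ}
    (hs : |s.re - 1 / 2| ≤ 9 / (5 * logD D)) (hi : |s.im - D| < 10 * logD D)
    (hz : z ∈ Metric.ball s (1 / (10 * logD D))) : 1 - starRingEnd ℂ z ∈ Omega₁ D := by
  refine mem_Omega₁_of_mem_ball hD (s := 1 - starRingEnd ℂ s) ?_ ?_ ?_
  · rw [sub_re, one_re, conj_re, show 1 - s.re - 1 / 2 = -(s.re - 1 / 2) by ring, abs_neg]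
    exact hs
  · simpa using hi
  · rw [Metric.mem_ball, dist_eq_norm] at hz ⊢
    rwa [sub_sub_sub_cancel_left, ← map_sub, norm_conj, norm_sub_rev]

theorem mem_Omega₁_of_near {D : ℕ} {C : ℝ} (hD : IsLarge D C) {s : ℂ}
    (hs : |s.re - 1 / 2| ≤ 2 * (2 * Real.log (logD D) / logD D) / logD D ^ 2)
    (hi : |s.im - D| < 10 * logD D) : s ∈ Omega₁ D := by
  have hL := hD.logD_ge
  have hL0 : 0 < logD D := by linarith
  have hll := hD.mul_log_le
  refine mem_Omega₁_of_mem_ball hD (s := s) (hs.trans ?_) hi (Metric.mem_ball_self (by positivity))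
  rw [div_le_div_iff₀ (by positivity) (by positivity), ← mul_div_assoc, div_mul_eq_mul_div,
    div_le_iff₀ hL0]
  nlinarith [pow_pos hL0 2, pow_pos hL0 3]

theorem mem_Omega_iff {D : ℕ} {s : ℂ} :
    s ∈ Omega D ↔ |s.re - 1 / 2| < 1 / 2 ∧ |s.im - D| < 10 * logD D := by
  rw [← sub_s₀_re, ← sub_s₀_im]; rfl

theorem isOpen_Omega₁ (D : ℕ) : IsOpen (Omega₁ D) := by
  have h1 : Continuous fun s : ℂ => (s - s₀ D).re := by fun_prop
  have h2 : Continuous fun s : ℂ => |(s - s₀ D).im| := by fun_prop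
  exact (isOpen_lt continuous_const h1).inter
    ((isOpen_lt h1 continuous_const).inter (isOpen_lt h2 continuous_const))

theorem one_sub_conj_eq_self {s : ℂ} (hs : s.re = 1 / 2) : 1 - starRingEnd ℂ s = s := by
  apply Complex.ext
  · simp [hs]; norm_num
  · simp

section

variable {D q : ℕ} [NeZero D] [NeZero q] {χ : DirichletCharacter ℂ D} {ψ : DirichletCharacter ℂ q}
  {C : ℝ}

theorem norm_F_lt (hψ : ψ ∈ PsiStar χ q) {s : ℂ} (hs : s ∈ Omega₁ D) :
    ‖F χ ψ s‖ < logD D ^ 3 * Real.log (logD D) := by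
  obtain ⟨b, hb, h⟩ := hψ.2.1
  linarith [h s hs, norm_nonneg (G χ ψ s)]

/-- A lower bound for `|F|`, since `|F G| > 1 / 2` and `|G|` is not large. -/
theorem one_lt_mul_norm_F (hψ : ψ ∈ PsiStar χ q) {s : ℂ} (hs : s ∈ Omega₁ D) :
    1 < 2 * (logD D ^ 3 * Real.log (logD D)) * ‖F χ ψ s‖ := by
  obtain ⟨b, hb, h⟩ := hψ.2.1
  obtain ⟨b', hb', h'⟩ := hψ.2.2.1
  have h1 : ‖G χ ψ s‖ < logD D ^ 3 * Real.log (logD D) := by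
    linarith [h s hs, norm_nonneg (F χ ψ s)]
  have h2 : ‖F χ ψ s * G χ ψ s - 1‖ < 1 / 2 := (h' s hs).trans_lt hb'
  have h3 := norm_sub_le (F χ ψ s * G χ ψ s) (F χ ψ s * G χ ψ s - 1)
  rw [sub_sub_cancel, norm_one, norm_mul] at h3
  nlinarith [norm_nonneg (F χ ψ s), norm_nonneg (G χ ψ s)]

theorem F_ne_zero (hψ : ψ ∈ PsiStar χ q) {s : ℂ} (hs : s ∈ Omega₁ D) : F χ ψ s ≠ 0 := by
  intro h
  have := one_lt_mul_norm_F hψ hs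
  rw [h, norm_zero, mul_zero] at this
  norm_num at this

theorem one_div_norm_F_le (hD : IsLarge D C) (hψ : ψ ∈ PsiStar χ q) {s : ℂ}
    (hs : s ∈ Omega₁ D) : 1 / ‖F χ ψ s‖ ≤ logD D ^ 5 := by
  rw [div_le_iff₀ (norm_pos_iff.2 (F_ne_zero hψ hs))]
  have := one_lt_mul_norm_F hψ hs
  have := two_mul_bound_le hD
  nlinarith [norm_nonneg (F χ ψ s)]

theorem abs_log_norm_F_le (hD : IsLarge D C) (hψ : ψ ∈ PsiStar χ q) {s : ℂ}
    (hs : s ∈ Omega₁ D) : |Real.log ‖F χ ψ s‖| ≤ 5 * Real.log (logD D) := by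
  have hp : 0 < ‖F χ ψ s‖ := norm_pos_iff.2 (F_ne_zero hψ hs)
  have e5 : 5 * Real.log (logD D) = Real.log (logD D ^ 5) := by rw [Real.log_pow]; norm_num
  have h0 := hD.logD_ge
  have h1 := norm_F_lt hψ hs
  have h2 := two_mul_bound_le hD
  have h3 : 0 < logD D ^ 3 * Real.log (logD D) := hp.trans h1
  rw [e5]
  refine abs_le.2 ⟨?_, Real.log_le_log hp (by linarith)⟩
  have h4 := Real.log_le_log (by positivity) (one_div_norm_F_le hD hψ hs)
  rw [one_div, Real.log_inv] at h4
  linarith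

theorem norm_logDeriv_F_le (hD : IsLarge D C) (hψ : ψ ∈ PsiStar χ q) {s : ℂ}
    (hs : |s.re - 1 / 2| ≤ 9 / (5 * logD D)) (hi : |s.im - D| < 10 * logD D) :
    ‖logDeriv (F χ ψ) s‖ ≤ 800 * Real.log (logD D) * logD D :=
  norm_logDeriv_le_of_ball hD (fun z _ => differentiableAt_F χ ψ z)
    (fun _ hz => F_ne_zero hψ (mem_Omega₁_of_mem_ball hD hs hi hz))
    (fun _ hz => abs_log_norm_F_le hD hψ (mem_Omega₁_of_mem_ball hD hs hi hz))

theorem F_inv_one_sub_ne_zero (hχ : ∀ a, (χ a).im = 0) (hψ : ψ ∈ PsiStar χ q) {s : ℂ}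
    (hs : 1 - starRingEnd ℂ s ∈ Omega₁ D) : F χ ψ⁻¹ (1 - s) ≠ 0 := by
  rw [← norm_ne_zero_iff, norm_F_inv_one_sub hχ, norm_ne_zero_iff]
  exact F_ne_zero hψ hs

theorem norm_logDeriv_F_inv_le (hD : IsLarge D C) (hχ : ∀ a, (χ a).im = 0) (hψ : ψ ∈ PsiStar χ q)
    {s : ℂ} (hs : |s.re - 1 / 2| ≤ 9 / (5 * logD D)) (hi : |s.im - D| < 10 * logD D) :
    ‖logDeriv (fun z => F χ ψ⁻¹ (1 - z)) s‖ ≤ 800 * Real.log (logD D) * logD D :=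
  norm_logDeriv_le_of_ball hD (fun z _ => differentiableAt_F_inv_one_sub χ ψ z)
    (fun _ hz => F_inv_one_sub_ne_zero hχ hψ (one_sub_conj_mem_Omega₁ hD hs hi hz))
    (fun _ hz => by
      rw [norm_F_inv_one_sub hχ]
      exact abs_log_norm_F_le hD hψ (one_sub_conj_mem_Omega₁ hD hs hi hz))

/-- The quotient of the two terms of `𝓕(s, ψ)`. -/
noncomputable def reflectedRatio (χ : DirichletCharacter ℂ D) (ψ : DirichletCharacter ℂ q)
    (s : ℂ) : ℂ :=
  Delta₁ χ ψ s * F χ ψ⁻¹ (1 - s) / F χ ψ s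

/-- The relative error in the approximation of `L(s, ψ) L(s, ψχ)` by `𝓕(s, ψ)`. -/
noncomputable def relError (χ : DirichletCharacter ℂ D) (ψ : DirichletCharacter ℂ q)
    (s : ℂ) : ℂ :=
  (LL χ ψ s - calF χ ψ s) / F χ ψ s

theorem LL_eq_F_mul (hψ : ψ ∈ PsiStar χ q) {s : ℂ} (hs : s ∈ Omega₁ D) :
    LL χ ψ s = F χ ψ s * (1 + reflectedRatio χ ψ s + relError χ ψ s) := by
  have := F_ne_zero hψ hs
  rw [reflectedRatio, relError, calF]
  field_simp
  ring

theorem one_lt_modulus (hψ : ψ ∈ PsiStar χ q) : 1 < q := by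
  have h1 := hψ.1.1
  have h2 : 1 ≤ bigQ D := Real.one_le_exp (by positivity)
  have h3 : (1 : ℝ) < q := by linarith
  exact_mod_cast h3

theorem differentiableAt_reflectedRatio (hψ : ψ ∈ PsiStar χ q) {s : ℂ}
    (hs : s ∈ Omega₁ D) (hi : s.im ≠ 0) : DifferentiableAt ℂ (reflectedRatio χ ψ) s :=
  ((differentiableAt_Delta₁ χ ψ hi).mul (differentiableAt_F_inv_one_sub χ ψ s)).div
    (differentiableAt_F χ ψ s) (F_ne_zero hψ hs)

theorem differentiableAt_relError (hψ : ψ ∈ PsiStar χ q) {s : ℂ}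
    (hs : s ∈ Omega₁ D) (hi : s.im ≠ 0) : DifferentiableAt ℂ (relError χ ψ) s :=
  ((differentiable_LL hψ.1.2.2.2.2.1 hψ.1.2.2.2.2.2 (one_lt_modulus hψ) s).sub
    ((differentiableAt_F χ ψ s).add
      ((differentiableAt_Delta₁ χ ψ hi).mul (differentiableAt_F_inv_one_sub χ ψ s)))).div
    (differentiableAt_F χ ψ s) (F_ne_zero hψ hs)

theorem norm_relError_le (hD : IsLarge D C) (hψ : ψ ∈ PsiStar χ q) {s : ℂ}
    (hs : s ∈ Omega₁ D) (hs2 : s ∈ Omega₂ D) :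
    ‖relError χ ψ s‖ ≤ 2 * Real.log (logD D) / logD D := by
  obtain ⟨b, hb, h⟩ := hψ.2.2.2
  have hL := hD.logD_ge
  have hL0 : 0 < logD D := by linarith
  have hl := hD.two_le_log
  have h1 : ‖LL χ ψ s - calF χ ψ s‖ ≤ 1 / logD D ^ 4 := by
    have h2 : logD D ^ (-(24 / 5) : ℝ) ≤ logD D ^ (-(4 : ℕ) : ℝ) :=
      Real.rpow_le_rpow_of_exponent_le (by linarith) (by norm_num)
    rw [Real.rpow_neg hL0.le, Real.rpow_neg hL0.le, Real.rpow_natCast,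
      ← Real.rpow_neg hL0.le, ← one_div] at h2
    linarith [h s hs2]
  have hF := F_ne_zero hψ hs
  have hF' := norm_pos_iff.2 hF
  have h3 := one_lt_mul_norm_F hψ hs
  rw [relError, norm_div, div_le_iff₀ hF']
  refine h1.trans ?_
  rw [div_mul_eq_mul_div, div_le_div_iff₀ (by positivity) hL0]
  calc 1 * logD D ≤ (2 * (logD D ^ 3 * Real.log (logD D)) * ‖F χ ψ s‖) * logD D := by gcongr
    _ = _ := by ring

theorem reflectedRatio_ne_zero (hχ : ∀ a, (χ a).im = 0) (hψ : ψ ∈ PsiStar χ q) {s : ℂ}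
    (hs : s ∈ Omega₁ D) (hs' : 1 - starRingEnd ℂ s ∈ Omega₁ D) (hi : s.im ≠ 0) :
    reflectedRatio χ ψ s ≠ 0 :=
  div_ne_zero (mul_ne_zero (Delta₁_ne_zero hψ.1.2.2.2.2.1 hψ.1.2.2.2.2.2 (one_lt_modulus hψ) hi)
    (F_inv_one_sub_ne_zero hχ hψ hs')) (F_ne_zero hψ hs)

/-- The factor `Δ₁` contributes `-2 ℒ² + O(ℒ)`, the factors `F` contribute `O(ℒ log ℒ)` each. -/
theorem norm_logDeriv_reflectedRatio_add_le (hD : IsLarge D C) (hχ : ∀ a, (χ a).im = 0)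
    (hψ : ψ ∈ PsiStar χ q) {s : ℂ} (hs : |s.re - 1 / 2| ≤ 9 / (5 * logD D))
    (hi : |s.im - D| < 10 * logD D) :
    ‖logDeriv (reflectedRatio χ ψ) s + 2 * (logD D : ℂ) ^ 2‖ ≤
      6600 * Real.log (logD D) * logD D := by
  have hL := hD.logD_ge
  have hL0 : 0 < logD D := by linarith
  have hmem : s ∈ Metric.ball s (1 / (10 * logD D)) := Metric.mem_ball_self (by positivity)
  have hs1 := mem_Omega₁_of_mem_ball hD hs hi hmem
  have hs2 := one_sub_conj_mem_Omega₁ hD hs hi hmem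
  obtain ⟨him, him2⟩ := hD.im_bounds (s := s) (by linarith)
  have hi0 : s.im ≠ 0 := by linarith
  have hΔ := Delta₁_ne_zero hψ.1.2.2.2.2.1 hψ.1.2.2.2.2.2 (one_lt_modulus hψ) hi0
  have hFi := F_inv_one_sub_ne_zero hχ hψ hs2
  have hld : logDeriv (reflectedRatio χ ψ) s =
      logDeriv (Delta₁ χ ψ) s + logDeriv (fun z => F χ ψ⁻¹ (1 - z)) s - logDeriv (F χ ψ) s := by
    have h1 := logDeriv_div (f := fun z => Delta₁ χ ψ z * F χ ψ⁻¹ (1 - z)) (g := F χ ψ) s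
      (mul_ne_zero hΔ hFi) (F_ne_zero hψ hs1)
      ((differentiableAt_Delta₁ χ ψ hi0).mul (differentiableAt_F_inv_one_sub χ ψ s))
      (differentiableAt_F χ ψ s)
    have h2 := logDeriv_mul (f := Delta₁ χ ψ) (g := fun z => F χ ψ⁻¹ (1 - z)) s hΔ hFi
      (differentiableAt_Delta₁ χ ψ hi0) (differentiableAt_F_inv_one_sub χ ψ s)
    rw [← h2]
    exact h1
  have hre : 9 / (5 * logD D) ≤ 1 / 2 := by
    rw [div_le_div_iff₀ (by positivity) (by norm_num)]; linarith
  have hD3 : 3 ≤ D := by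
    have := hD.ten_mul_logD_le
    have h3 : (3 : ℝ) ≤ D := by linarith
    exact_mod_cast h3
  have hb1 := norm_logDeriv_Delta₁_add_le hψ.1.2.2.2.2.1 hψ.1.2.2.2.2.2 hD3 hψ.1.1 hψ.1.2.1
    (s := s) (by linarith [(abs_le.1 hs).1]) (by linarith [(abs_le.1 hs).2]) him him2
  have hb2 := norm_logDeriv_F_le hD hψ hs hi
  have hb3 := norm_logDeriv_F_inv_le hD hχ hψ hs hi
  rw [hld, show logDeriv (Delta₁ χ ψ) s + logDeriv (fun z => F χ ψ⁻¹ (1 - z)) s -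
    logDeriv (F χ ψ) s + 2 * (logD D : ℂ) ^ 2 = (logDeriv (Delta₁ χ ψ) s + 2 * (logD D : ℂ) ^ 2) +
      logDeriv (fun z => F χ ψ⁻¹ (1 - z)) s - logDeriv (F χ ψ) s by ring]
  refine (norm_sub_le _ _).trans ?_
  have h4 := norm_add_le (logDeriv (Delta₁ χ ψ) s + 2 * (logD D : ℂ) ^ 2)
    (logDeriv (fun z => F χ ψ⁻¹ (1 - z)) s)
  have := hD.two_le_log
  nlinarith

theorem norm_reflectedRatio_critical (hχ : ∀ a, (χ a).im = 0) (hψ : ψ ∈ PsiStar χ q) {s : ℂ}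
    (hs : s ∈ Omega₁ D) (hre : s.re = 1 / 2) (hi : s.im ≠ 0) : ‖reflectedRatio χ ψ s‖ = 1 := by
  rw [reflectedRatio, norm_div, norm_mul, norm_Delta₁_critical hψ.1.2.2.2.2.1 hψ.1.2.2.2.2.2
    (one_lt_modulus hψ) hi hre, norm_F_inv_one_sub hχ, one_sub_conj_eq_self hre, one_mul,
    div_self (norm_ne_zero_iff.2 (F_ne_zero hψ hs))]

/-- The functional equation of `L(s, ψ) L(s, ψχ)` on the critical line, divided by `F`. -/
theorem conj_mul_reflectedRatio_critical (hχ : ∀ a, (χ a).im = 0) (hψ : ψ ∈ PsiStar χ q) {s : ℂ}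
    (hs : s ∈ Omega₁ D) (hre : s.re = 1 / 2) (hi : s.im ≠ 0) :
    starRingEnd ℂ (1 + reflectedRatio χ ψ s + relError χ ψ s) * reflectedRatio χ ψ s =
      1 + reflectedRatio χ ψ s + relError χ ψ s := by
  have hF := F_ne_zero hψ hs
  have hcF : starRingEnd ℂ (F χ ψ s) ≠ 0 := by simpa using hF
  have h1 : 1 + reflectedRatio χ ψ s + relError χ ψ s = LL χ ψ s / F χ ψ s := by
    rw [LL_eq_F_mul hψ hs, mul_div_cancel_left₀ _ hF]
  have h2 := LL_eq_Delta₁_mul_conj hψ.1.2.2.2.2.1 hψ.1.2.2.2.2.2 (one_lt_modulus hψ) hi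
  rw [one_sub_conj_eq_self hre] at h2
  rw [h1, map_div₀, reflectedRatio, F_inv_one_sub hχ, one_sub_conj_eq_self hre]
  nth_rewrite 2 [h2]
  field_simp

/-- Here `N = ℒ²`, and both relative errors `κ` and `ε` are multiples of `log ℒ / ℒ`; the bound for
the derivative of `relError` is Cauchy's estimate on discs of radius `1 / (10 ℒ²)`. -/
theorem nearCritical (hD : IsLarge D C) (hχ : ∀ a, (χ a).im = 0) (hψ : ψ ∈ PsiStar χ q) :
    NearCritical (reflectedRatio χ ψ) (relError χ ψ) D (10 * logD D) (logD D ^ 2)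
      (3300 * Real.log (logD D) / logD D) (2 * Real.log (logD D) / logD D) := by
  have hL := hD.logD_ge
  have hL0 : 0 < logD D := by linarith
  have hl := hD.two_le_log
  have hll := hD.mul_log_le
  have hwide : 1 / (20 * logD D ^ 2) ≤ 9 / (5 * logD D) := by
    rw [div_le_div_iff₀ (by positivity) (by positivity)]; nlinarith
  have hmem : ∀ s : ℂ, s ∈ Metric.ball s (1 / (10 * logD D)) :=
    fun s => Metric.mem_ball_self (by positivity)
  have hnz : ∀ s : ℂ, |s.im - D| < 1 + 10 * logD D → s.im ≠ 0 := fun s hs => by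
    linarith [(hD.im_bounds hs).1]
  -- discs of radius `1 / (10 ℒ²)` about the points of the strip
  have hball : ∀ s : ℂ, |s.re - 1 / 2| ≤ 1 / (20 * logD D ^ 2) → |s.im - D| < 10 * logD D →
      ∀ z ∈ Metric.closedBall s (1 / (10 * logD D ^ 2)),
        z ∈ Omega₁ D ∧ z ∈ Omega₂ D ∧ z.im ≠ 0 := by
    intro s hs hi z hz
    rw [Metric.mem_closedBall, dist_eq_norm] at hz
    have hr := (abs_re_le_norm (z - s)).trans hz
    have hi' := (abs_im_le_norm (z - s)).trans hz
    rw [sub_re] at hr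
    rw [sub_im] at hi'
    have e0 : 1 / (20 * logD D ^ 2) + 1 / (10 * logD D ^ 2) = (3 / 20) / logD D ^ 2 := by
      field_simp; norm_num
    have e1 : (3 / 20) / logD D ^ 2 < Real.log (logD D) / (10 * logD D ^ 2) := by
      rw [div_lt_div_iff₀ (by positivity) (by positivity)]
      nlinarith [pow_pos hL0 2]
    have e2 : (3 / 20) / logD D ^ 2 < 2 / logD D := by
      rw [div_lt_div_iff₀ (by positivity) (by positivity)]
      nlinarith
    have e3 : 2 / logD D < 1 / 2 := by
      rw [div_lt_div_iff₀ (by positivity) (by norm_num)]; linarith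
    have e4 : 1 / (10 * logD D ^ 2) < 1 := by
      rw [div_lt_one (by positivity)]; nlinarith
    have hzr : |z.re - 1 / 2| ≤ (3 / 20) / logD D ^ 2 := by
      have := abs_sub_le z.re s.re (1 / 2)
      linarith
    have hzi : |z.im - D| < 1 + 10 * logD D := by
      have := abs_sub_le z.im s.im D
      linarith
    refine ⟨mem_Omega₁ hL0 ?_ ?_ (by linarith), mem_Omega₂ ?_ ?_ hzi, hnz z hzi⟩
    · linarith [(abs_le.1 hzr).1]
    · linarith [(abs_le.1 hzr).2]
    · linarith [(abs_le.1 hzr).1]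
    · linarith [(abs_le.1 hzr).2]
  have hself : ∀ s : ℂ, s ∈ Metric.closedBall s (1 / (10 * logD D ^ 2)) :=
    fun s => Metric.mem_closedBall_self (by positivity)
  have hnz' : ∀ s : ℂ, |s.im - D| < 10 * logD D → s.im ≠ 0 := fun s hs => hnz s (by linarith)
  refine ⟨by positivity, by positivity, ?_, by positivity, ?_, ?_, ?_, ?_, ?_, ?_, ?_, ?_⟩
  · rw [div_le_div_iff₀ hL0 (by norm_num)]; linarith
  · rw [div_le_div_iff₀ hL0 (by norm_num)]; linarith
  · exact fun s hs hi =>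
      differentiableAt_reflectedRatio hψ (hball s hs hi s (hself s)).1 (hnz' s hi)
  · exact fun s hs hi => reflectedRatio_ne_zero hχ hψ (hball s hs hi s (hself s)).1
      (one_sub_conj_mem_Omega₁ hD (hs.trans hwide) hi (hmem s)) (hnz' s hi)
  · intro s hs hi
    have := norm_logDeriv_reflectedRatio_add_le hD hχ hψ (hs.trans hwide) hi
    push_cast
    refine this.trans (le_of_eq ?_)
    field_simp
    ring
  · intro s hre hi
    have hs : |s.re - 1 / 2| ≤ 1 / (20 * logD D ^ 2) := by
      rw [hre, sub_self, abs_zero]; positivity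
    exact norm_reflectedRatio_critical hχ hψ (hball s hs hi s (hself s)).1 hre (hnz' s hi)
  · exact fun s hs hi => differentiableAt_relError hψ (hball s hs hi s (hself s)).1 (hnz' s hi)
  · exact fun s hs hi => norm_relError_le hD hψ (hball s hs hi s (hself s)).1
      (hball s hs hi s (hself s)).2.1
  · intro s hs hi
    have hdc : DiffContOnCl ℂ (relError χ ψ) (Metric.ball s (1 / (10 * logD D ^ 2))) := by
      apply DifferentiableOn.diffContOnCl
      rw [closure_ball s (by positivity)]
      exact fun w hw => (differentiableAt_relError hψ (hball s hs hi w hw).1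
        (hball s hs hi w hw).2.2).differentiableWithinAt
    refine (norm_deriv_le_of_forall_mem_sphere_norm_le
      (C := 2 * Real.log (logD D) / logD D) (by positivity) hdc ?_).trans (le_of_eq ?_)
    · intro w hw
      have hw' := hball s hs hi w (Metric.sphere_subset_closedBall hw)
      exact norm_relError_le hD hψ hw'.1 hw'.2.1
    · field_simp

/-! ### The zeros of `L(s, ψ) L(s, ψχ)` in `Ω` -/

theorem norm_Delta₁_le_exp (hD : IsLarge D C) (hψ : ψ ∈ PsiStar χ q) {s : ℂ}
    (h1 : 1 / 2 ≤ s.re) (h2 : s.re ≤ 1) (hi : |s.im - D| < 1 + 10 * logD D) :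
    ‖Delta₁ χ ψ s‖ ≤ Real.exp (-(2 * logD D ^ 2 - 5000 * logD D) * (s.re - 1 / 2)) := by
  obtain ⟨him, him2⟩ := hD.im_bounds hi
  have hi0 : s.im ≠ 0 := by linarith
  have hq := one_lt_modulus hψ
  obtain ⟨⟨hq1, hq2, -, -, hp1, hp2⟩, -⟩ := hψ
  have hD3 : 3 ≤ D := by
    have := hD.ten_mul_logD_le
    have := hD.logD_ge
    have h3 : (3 : ℝ) ≤ D := by linarith
    exact_mod_cast h3
  have himx : ∀ x : ℝ, ((x : ℂ) + s.im * I).im = s.im := fun x => by simp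
  have hrex : ∀ x : ℝ, ((x : ℂ) + s.im * I).re = x := fun x => by simp
  have h := norm_le_exp_mul_of_re_logDeriv_le (f := Delta₁ χ ψ) (a := 1 / 2) (b := s.re)
    (t := s.im) (M := 2 * logD D ^ 2 - 5000 * logD D) h1
    (fun x _ => differentiableAt_Delta₁ χ ψ (by rwa [himx]))
    (fun x _ => Delta₁_ne_zero hp1 hp2 hq (by rwa [himx]))
    (fun x hx => by
      have h3 := (re_le_norm _).trans (norm_logDeriv_Delta₁_add_le hp1 hp2 hD3 hq1 hq2
        (s := x + s.im * I) (by rw [hrex]; linarith [hx.1]) (by rw [hrex]; linarith [hx.2])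
        (by rwa [himx]) (by rwa [himx]))
      rw [show (2 * (logD D : ℂ) ^ 2) = ((2 * logD D ^ 2 : ℝ) : ℂ) by push_cast; ring, add_re,
        ofReal_re] at h3
      linarith)
  rwa [norm_Delta₁_critical hp1 hp2 hq (by rwa [himx]) (hrex _), mul_one, re_add_im] at h

/-- Away from the critical line, the decay of `Δ₁` beats the trivial bound for `F(1 - s, ψ̄)`: at
distance `9 / (5 ℒ)` the former is about `exp (-18 ℒ / 5)`, the latter about `exp (3 ℒ)`. -/
theorem norm_reflectedRatio_le_half (hD : IsLarge D C) (hC : 0 < C)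
    (hF : ∀ s : ℂ, s.re ≤ 11 / 10 → ‖F χ ψ s‖ ≤ C * (D : ℝ) ^ (5 * (11 / 10 - s.re)))
    (hχ : ∀ a, (χ a).im = 0) (hψ : ψ ∈ PsiStar χ q) {s : ℂ}
    (h1 : 9 / (5 * logD D) ≤ s.re - 1 / 2) (h2 : s.re ≤ 1) (hi : |s.im - D| < 1 + 10 * logD D)
    (hs : s ∈ Omega₁ D) : ‖reflectedRatio χ ψ s‖ ≤ 1 / 2 := by
  have hL := hD.logD_ge
  have hL0 : 0 < logD D := by linarith
  have hl := hD.two_le_log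
  have hll := hD.mul_log_le
  set δ := s.re - 1 / 2 with hδ
  have hδ0 : 0 < δ := lt_of_lt_of_le (by positivity) h1
  have hLδ : 9 / 5 ≤ logD D * δ := by
    have : logD D * (9 / (5 * logD D)) ≤ logD D * δ := by gcongr
    refine le_trans (le_of_eq ?_) this
    field_simp
  have b1 := norm_Delta₁_le_exp hD hψ (s := s) (by linarith) h2 hi
  rw [← hδ] at b1
  have b2 : ‖F χ ψ⁻¹ (1 - s)‖ ≤ Real.exp (Real.log C + logD D * (3 + 5 * δ)) := by
    rw [norm_F_inv_one_sub hχ]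
    have hre : (1 - starRingEnd ℂ s).re = 1 / 2 - δ := by
      simp only [sub_re, one_re, conj_re, hδ]; ring
    refine (hF _ (by rw [hre]; linarith)).trans (le_of_eq ?_)
    rw [hre, Real.exp_add, Real.exp_log hC, Real.rpow_def_of_pos hD.D_pos, logD]
    congr 3
    ring
  have b3 : 1 / ‖F χ ψ s‖ ≤ Real.exp (5 * Real.log (logD D)) := by
    refine (one_div_norm_F_le hD hψ hs).trans (le_of_eq ?_)
    rw [mul_comm, Real.exp_mul, hD.exp_log]
    norm_cast
  have hexp : -(2 * logD D ^ 2 - 5000 * logD D) * δ + (Real.log C + logD D * (3 + 5 * δ)) +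
      5 * Real.log (logD D) ≤ -1 := by
    have h3 := hD.log_const_le
    have h4 : 5005 * (logD D * δ) ≤ logD D / 100 * (logD D * δ) := by gcongr; linarith
    have h5 : logD D * (9 / 5) ≤ logD D * (logD D * δ) := by gcongr
    nlinarith
  rw [reflectedRatio, norm_div, norm_mul, div_eq_mul_one_div]
  calc ‖Delta₁ χ ψ s‖ * ‖F χ ψ⁻¹ (1 - s)‖ * (1 / ‖F χ ψ s‖)
      ≤ Real.exp (-(2 * logD D ^ 2 - 5000 * logD D) * δ) *
        Real.exp (Real.log C + logD D * (3 + 5 * δ)) * Real.exp (5 * Real.log (logD D)) := by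
        gcongr
    _ = Real.exp (-(2 * logD D ^ 2 - 5000 * logD D) * δ + (Real.log C + logD D * (3 + 5 * δ)) +
      5 * Real.log (logD D)) := by rw [← Real.exp_add, ← Real.exp_add]
    _ ≤ Real.exp (-1) := Real.exp_le_exp.2 hexp
    _ ≤ 1 / 2 := by
        have := Real.exp_neg_one_lt_d9
        linarith

theorem norm_reflectedRatio_le_exp (hD : IsLarge D C) (hχ : ∀ a, (χ a).im = 0)
    (hψ : ψ ∈ PsiStar χ q) {s : ℂ} (h1 : 1 / 2 ≤ s.re) (h2 : s.re - 1 / 2 ≤ 9 / (5 * logD D))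
    (hi : |s.im - D| < 10 * logD D) :
    ‖reflectedRatio χ ψ s‖ ≤ Real.exp (-logD D ^ 2 * (s.re - 1 / 2)) := by
  have hL := hD.logD_ge
  have hL0 : 0 < logD D := by linarith
  have hll := hD.mul_log_le
  have hl := hD.two_le_log
  have hi0 : s.im ≠ 0 := by linarith [(hD.im_bounds (s := s) (by linarith)).1]
  have himx : ∀ x : ℝ, ((x : ℂ) + s.im * I).im = s.im := fun x => by simp
  have hrex : ∀ x : ℝ, ((x : ℂ) + s.im * I).re = x := fun x => by simp
  have hstrip : ∀ x ∈ Set.Icc (1 / 2) s.re,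
      |((x : ℂ) + s.im * I).re - 1 / 2| ≤ 9 / (5 * logD D) := fun x hx => by
    rw [hrex, abs_of_nonneg (by linarith [hx.1])]
    linarith [hx.2]
  have hball : ∀ z : ℂ, z ∈ Metric.ball z (1 / (10 * logD D)) :=
    fun z => Metric.mem_ball_self (by positivity)
  have hmem : ∀ x ∈ Set.Icc (1 / 2) s.re, (x : ℂ) + s.im * I ∈ Omega₁ D := fun x hx =>
    mem_Omega₁_of_mem_ball hD (hstrip x hx) (by rwa [himx]) (hball _)
  have h := norm_le_exp_mul_of_re_logDeriv_le (f := reflectedRatio χ ψ) (a := 1 / 2) (b := s.re)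
    (t := s.im) (M := logD D ^ 2) h1
    (fun x hx => differentiableAt_reflectedRatio hψ (hmem x hx) (by rwa [himx]))
    (fun x hx => reflectedRatio_ne_zero hχ hψ (hmem x hx)
      (one_sub_conj_mem_Omega₁ hD (hstrip x hx) (by rwa [himx]) (hball _)) (by rwa [himx]))
    (fun x hx => by
      have h3 := (re_le_norm _).trans (norm_logDeriv_reflectedRatio_add_le hD hχ hψ
        (hstrip x hx) (by rwa [himx]))
      rw [show (2 * (logD D : ℂ) ^ 2) = ((2 * logD D ^ 2 : ℝ) : ℂ) by push_cast; ring, add_re,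
        ofReal_re] at h3
      nlinarith)
  rwa [norm_reflectedRatio_critical hχ hψ (hmem _ ⟨le_rfl, h1⟩) (hrex _) (by rwa [himx]), mul_one,
    re_add_im] at h

/-- Zeros to the right of the critical line lie within `4 (log ℒ) / ℒ³` of it: there the ratio of
the two terms of `𝓕` is too small to cancel the leading `1`. -/
theorem re_sub_half_le_of_zero (hD : IsLarge D C) (hC : 0 < C)
    (hF : ∀ s : ℂ, s.re ≤ 11 / 10 → ‖F χ ψ s‖ ≤ C * (D : ℝ) ^ (5 * (11 / 10 - s.re)))
    (hχ : ∀ a, (χ a).im = 0) (hψ : ψ ∈ PsiStar χ q) {s : ℂ} (h1 : 1 / 2 ≤ s.re) (h2 : s.re < 1)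
    (hi : |s.im - D| < 10 * logD D) (h0 : LL χ ψ s = 0) :
    s.re - 1 / 2 ≤ 2 * (2 * Real.log (logD D) / logD D) / logD D ^ 2 := by
  have hL := hD.logD_ge
  have hL0 : 0 < logD D := by linarith
  have hll := hD.mul_log_le
  have hl := hD.two_le_log
  have p1 : (0 : ℝ) < 2 / logD D := by positivity
  have p2 : 0 < Real.log (logD D) / (10 * logD D ^ 2) := by positivity
  have hs1 : s ∈ Omega₁ D := mem_Omega₁ hL0 (by linarith) (by linarith) (by linarith)
  have hs2 : s ∈ Omega₂ D := mem_Omega₂ (by linarith) (by linarith) (by linarith)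
  have he := norm_relError_le hD hψ hs1 hs2
  set ε := 2 * Real.log (logD D) / logD D with hε
  have hε1 : ε ≤ 1 / 4 := by
    rw [hε, div_le_div_iff₀ hL0 (by norm_num)]; linarith
  have hε0 : 0 < ε := by positivity
  rw [LL_eq_F_mul hψ hs1, mul_eq_zero, or_iff_right (F_ne_zero hψ hs1)] at h0
  have hB : 1 - ε ≤ ‖reflectedRatio χ ψ s‖ := by
    have h3 : (1 : ℂ) = -(reflectedRatio χ ψ s + relError χ ψ s) := by linear_combination h0
    have h4 := norm_add_le (reflectedRatio χ ψ s) (relError χ ψ s)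
    rw [← norm_neg (reflectedRatio χ ψ s + relError χ ψ s), ← h3, norm_one] at h4
    linarith
  rcases le_total (s.re - 1 / 2) (9 / (5 * logD D)) with hle | hle
  · have h3 := norm_reflectedRatio_le_exp hD hχ hψ h1 hle hi
    set y := logD D ^ 2 * (s.re - 1 / 2) with hy
    have hy0 : 0 ≤ y := mul_nonneg (by positivity) (by linarith)
    have h4 : (1 - ε) * Real.exp y ≤ 1 := by
      have h5 : (1 - ε) * Real.exp y ≤ Real.exp (-y) * Real.exp y := by
        gcongr
        rw [neg_mul, ← hy] at h3
        exact hB.trans h3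
      rwa [← Real.exp_add, neg_add_cancel, Real.exp_zero] at h5
    have h5 := Real.add_one_le_exp y
    rw [le_div_iff₀ (by positivity)]
    have h6 : (1 - ε) * (y + 1) ≤ 1 := le_trans (by gcongr; linarith) h4
    nlinarith
  · have h3 := norm_reflectedRatio_le_half hD hC hF hχ hψ hle h2.le (by linarith) hs1
    linarith

theorem LL_reflect_eq_zero (hψ : ψ ∈ PsiStar χ q) {s : ℂ} (hi : s.im ≠ 0) (h0 : LL χ ψ s = 0) :
    LL χ ψ (1 - starRingEnd ℂ s) = 0 := by
  rw [LL_eq_Delta₁_mul_conj hψ.1.2.2.2.2.1 hψ.1.2.2.2.2.2 (one_lt_modulus hψ) hi, mul_eq_zero,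
    or_iff_right (Delta₁_ne_zero hψ.1.2.2.2.2.1 hψ.1.2.2.2.2.2 (one_lt_modulus hψ) hi)] at h0
  simpa using h0

theorem abs_re_sub_half_le_of_zero (hD : IsLarge D C) (hC : 0 < C)
    (hF : ∀ s : ℂ, s.re ≤ 11 / 10 → ‖F χ ψ s‖ ≤ C * (D : ℝ) ^ (5 * (11 / 10 - s.re)))
    (hχ : ∀ a, (χ a).im = 0) (hψ : ψ ∈ PsiStar χ q) {s : ℂ} (hs : s ∈ Omega D)
    (h0 : LL χ ψ s = 0) :
    |s.re - 1 / 2| ≤ 2 * (2 * Real.log (logD D) / logD D) / logD D ^ 2 := by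
  obtain ⟨hr, hi⟩ := mem_Omega_iff.1 hs
  obtain ⟨hr1, hr2⟩ := abs_lt.1 hr
  have hi0 : s.im ≠ 0 := by linarith [(hD.im_bounds (s := s) (by linarith)).1]
  rcases le_total (1 / 2) s.re with hle | hle
  · rw [abs_of_nonneg (by linarith)]
    exact re_sub_half_le_of_zero hD hC hF hχ hψ hle (by linarith) hi h0
  · have hre : (1 - starRingEnd ℂ s).re = 1 - s.re := by simp
    have h1 := re_sub_half_le_of_zero hD hC hF hχ hψ (s := 1 - starRingEnd ℂ s)
      (by rw [hre]; linarith) (by rw [hre]; linarith) (by simpa using hi)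
      (LL_reflect_eq_zero hψ hi0 h0)
    rw [hre] at h1
    rw [abs_of_nonpos (by linarith)]
    linarith

theorem equation_of_zero (hψ : ψ ∈ PsiStar χ q) {s : ℂ} (hs : s ∈ Omega₁ D) :
    LL χ ψ s = 0 ↔ 1 + reflectedRatio χ ψ s + relError χ ψ s = 0 := by
  rw [LL_eq_F_mul hψ hs, mul_eq_zero, or_iff_right (F_ne_zero hψ hs)]

theorem zero_re_eq_half (hD : IsLarge D C) (hC : 0 < C)
    (hF : ∀ s : ℂ, s.re ≤ 11 / 10 → ‖F χ ψ s‖ ≤ C * (D : ℝ) ^ (5 * (11 / 10 - s.re)))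
    (hχ : ∀ a, (χ a).im = 0) (hψ : ψ ∈ PsiStar χ q) {s : ℂ} (hs : s ∈ Omega D)
    (h0 : LL χ ψ s = 0) : s.re = 1 / 2 := by
  have hnear := abs_re_sub_half_le_of_zero hD hC hF hχ hψ hs h0
  obtain ⟨hr, hi⟩ := mem_Omega_iff.1 hs
  have hi0 : s.im ≠ 0 := by linarith [(hD.im_bounds (s := s) (by linarith)).1]
  have hs1 := mem_Omega₁_of_near hD hnear hi
  have hs1' : 1 - starRingEnd ℂ s ∈ Omega₁ D := by
    refine mem_Omega₁_of_near hD ?_ (by simpa using hi)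
    rw [sub_re, one_re, conj_re, show 1 - s.re - 1 / 2 = -(s.re - 1 / 2) by ring, abs_neg]
    exact hnear
  exact (nearCritical hD hχ hψ).re_eq_half hnear hi ((equation_of_zero hψ hs1).1 h0)
    ((equation_of_zero hψ hs1').1 (LL_reflect_eq_zero hψ hi0 h0))

theorem analyticOrderAt_zero_eq_one (hD : IsLarge D C) (hC : 0 < C)
    (hF : ∀ s : ℂ, s.re ≤ 11 / 10 → ‖F χ ψ s‖ ≤ C * (D : ℝ) ^ (5 * (11 / 10 - s.re)))
    (hχ : ∀ a, (χ a).im = 0) (hψ : ψ ∈ PsiStar χ q) {s : ℂ} (hs : s ∈ Omega D)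
    (h0 : LL χ ψ s = 0) : analyticOrderAt (LL χ ψ) s = 1 := by
  have hnear := abs_re_sub_half_le_of_zero hD hC hF hχ hψ hs h0
  obtain ⟨hr, hi⟩ := mem_Omega_iff.1 hs
  have hi0 : s.im ≠ 0 := by linarith [(hD.im_bounds (s := s) (by linarith)).1]
  have hs1 := mem_Omega₁_of_near hD hnear hi
  have heq := (equation_of_zero hψ hs1).1 h0
  refine AnalyticAt.analyticOrderAt_eq_one_of_zero_deriv_ne_zero
    ((differentiable_LL hψ.1.2.2.2.2.1 hψ.1.2.2.2.2.2 (one_lt_modulus hψ)).analyticAt s) h0 ?_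
  have hev : LL χ ψ =ᶠ[nhds s]
      fun z => F χ ψ z * (1 + reflectedRatio χ ψ z + relError χ ψ z) := by
    filter_upwards [(isOpen_Omega₁ D).mem_nhds hs1] with z hz
    exact LL_eq_F_mul hψ hz
  have hd := (differentiableAt_F χ ψ s).hasDerivAt.mul
    (((differentiableAt_reflectedRatio hψ hs1 hi0).hasDerivAt.const_add 1).add
      (differentiableAt_relError hψ hs1 hi0).hasDerivAt)
  rw [hev.deriv_eq]
  have hd' := (show HasDerivAt
    (fun z => F χ ψ z * (1 + reflectedRatio χ ψ z + relError χ ψ z)) _ s from hd).deriv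
  rw [hd']
  simp only [Pi.add_apply]
  rw [heq, mul_zero, zero_add]
  exact mul_ne_zero (F_ne_zero hψ hs1) ((nearCritical hD hχ hψ).deriv_ne_zero hnear hi heq)

theorem abs_consecutive_sub_le (hD : IsLarge D C) (hC : 0 < C)
    (hF : ∀ s : ℂ, s.re ≤ 11 / 10 → ‖F χ ψ s‖ ≤ C * (D : ℝ) ^ (5 * (11 / 10 - s.re)))
    (hχ : ∀ a, (χ a).im = 0) (hψ : ψ ∈ PsiStar χ q) {ρ₁ ρ₂ : ℂ}
    (h : Consecutive (zerosIn (LL χ ψ) (Omega D)) ρ₁ ρ₂) :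
    |‖ρ₁ - ρ₂‖ - Real.pi * alpha D| ≤
      23114 * (Real.log (logD D) ^ 2 / logD D ^ 3) := by
  obtain ⟨⟨hΩ₁, h₁⟩, ⟨hΩ₂, h₂⟩, hlt, hcons⟩ := h
  have hL := hD.logD_ge
  have hL0 : 0 < logD D := by linarith
  have hl := hD.two_le_log
  have hcrit : ∀ ρ : ℂ, ρ.re = 1 / 2 → (1 / 2 + ρ.im * I : ℂ) = ρ := fun ρ hρ => by
    apply Complex.ext <;> simp [hρ]
  have hre₁ := zero_re_eq_half hD hC hF hχ hψ hΩ₁ h₁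
  have hre₂ := zero_re_eq_half hD hC hF hχ hψ hΩ₂ h₂
  obtain ⟨-, hi₁⟩ := mem_Omega_iff.1 hΩ₁
  obtain ⟨-, hi₂⟩ := mem_Omega_iff.1 hΩ₂
  have hmem : ∀ t : ℝ, |t - D| < 10 * logD D → (1 / 2 + t * I : ℂ) ∈ Omega₁ D ∧
      (1 / 2 + t * I : ℂ) ∈ Omega D ∧ (1 / 2 + t * I : ℂ).im ≠ 0 := by
    intro t ht
    have hr : (1 / 2 + t * I : ℂ).re = 1 / 2 := by simp
    have him : (1 / 2 + t * I : ℂ).im = t := by simp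
    refine ⟨mem_Omega₁_of_near hD ?_ (by rwa [him]), mem_Omega_iff.2 ⟨?_, by rwa [him]⟩, ?_⟩
    · rw [hr, sub_self, abs_zero]; positivity
    · rw [hr, sub_self, abs_zero]; norm_num
    · linarith [(hD.im_bounds (s := 1 / 2 + t * I) (by rw [him]; linarith)).1]
  have hgap := (nearCritical hD hχ hψ).abs_zero_gap_sub_le
    (fun t ht => conj_mul_reflectedRatio_critical hχ hψ (hmem t ht).1 (by simp) (hmem t ht).2.2)
    hlt hi₁ hi₂
    ((equation_of_zero hψ (hmem _ hi₁).1).1 (by rwa [hcrit ρ₁ hre₁]))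
    ((equation_of_zero hψ (hmem _ hi₂).1).1 (by rwa [hcrit ρ₂ hre₂]))
    (fun t ht h0 => by
      have hti : |t - D| < 10 * logD D :=
        abs_lt.2 ⟨by linarith [ht.1, (abs_lt.1 hi₁).1], by linarith [ht.2, (abs_lt.1 hi₂).2]⟩
      refine hcons (1 / 2 + t * I)
        ⟨(hmem t hti).2.1, (equation_of_zero hψ (hmem t hti).1).2 h0⟩ ?_
      simpa using ht)
  have hnorm : ‖ρ₁ - ρ₂‖ = ρ₂.im - ρ₁.im := by
    have h3 : ρ₁ - ρ₂ = ((ρ₁.im - ρ₂.im : ℝ) : ℂ) * I := by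
      apply Complex.ext <;> simp [hre₁, hre₂]
    rw [h3, norm_mul, norm_I, mul_one, norm_real, Real.norm_eq_abs, abs_of_neg (by linarith)]
    ring
  rw [hnorm, alpha_eq, mul_one_div]
  refine hgap.trans ?_
  have h4 : 7 * (3300 * Real.log (logD D) / logD D + 2 * Real.log (logD D) / logD D) /
      logD D ^ 2 = 23114 * (Real.log (logD D) / logD D ^ 3) := by
    field_simp; norm_num
  rw [h4]
  gcongr
  nlinarith

end

end DirichletZeros

/-- The constants `D₀` and `C` are absolute. The modulus `D` is large, `χ` is a real primitive
character modulo `D`, and `ψ` is any member of `Ψ*`. -/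
theorem proposition3p1 :
    ∃ (D₀ : ℕ) (C : ℝ), ∀ (D : ℕ) [NeZero D] (χ : DirichletCharacter ℂ D) (q : ℕ) [NeZero q]
      (ψ : DirichletCharacter ℂ q),
      D₀ ≤ D → χ.IsPrimitive → (∀ a, (χ a).im = 0) → ψ ∈ DirichletZeros.PsiStar χ q →
      (∀ ρ ∈ DirichletZeros.zerosIn (DirichletZeros.LL χ ψ) (DirichletZeros.Omega D),
        ρ.re = 1 / 2) ∧
      (∀ ρ ∈ DirichletZeros.zerosIn (DirichletZeros.LL χ ψ) (DirichletZeros.Omega D),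
        analyticOrderAt (DirichletZeros.LL χ ψ) ρ = 1) ∧
      (∀ ρ₁ ρ₂ : ℂ,
        DirichletZeros.Consecutive
          (DirichletZeros.zerosIn (DirichletZeros.LL χ ψ) (DirichletZeros.Omega D)) ρ₁ ρ₂ →
        |‖ρ₁ - ρ₂‖ - Real.pi * DirichletZeros.alpha D| ≤
          C * (Real.log (DirichletZeros.logD D) ^ 2 / DirichletZeros.logD D ^ 3)) := by
  obtain ⟨C, hC, hF⟩ := DirichletZeros.exists_norm_F_le
  obtain ⟨D₀, hD₀⟩ := DirichletZeros.exists_isLarge C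
  refine ⟨D₀, 23114, ?_⟩
  intro D _ χ q _ ψ hD _ hχ hψ
  have hF' := fun s hs => hF D q χ ψ s (NeZero.one_le) hs
  exact ⟨fun ρ hρ => DirichletZeros.zero_re_eq_half (hD₀ D hD) hC hF' hχ hψ hρ.1 hρ.2,
    fun ρ hρ => DirichletZeros.analyticOrderAt_zero_eq_one (hD₀ D hD) hC hF' hχ hψ hρ.1 hρ.2,
    fun ρ₁ ρ₂ h => DirichletZeros.abs_consecutive_sub_le (hD₀ D hD) hC hF' hχ hψ h⟩
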